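/- Let $M$ be a smooth $n$-dimensional manifold with a smooth pseudo-Riemannian metric $g$, let $G=g^{-1}$ be the inverse metric on $T^*M$, and let $H(p)=\tfrac12 G(p,p)$, $p\in T^*M$, be the geodesic Hamiltonian of $g$. In the canonical coordinates $(x^i,p_i)$ of $T^*M$ induced by coordinates $(x^i)$ of $M$ let $\{F,K\}=\sum_i\bigl(\frac{\partial F}{\partial x^i}\frac{\partial K}{\partial p_i}-\frac{\partial K}{\partial x^i}\frac{\partial F}{\partial p_i}\bigr)$. Let $U\subseteq T^*M$ be open (for instance $T^*M$, or $T^*M$ without the zero section) and let $f_1,\dots,f_n$ be smooth functions on $U$ such that $\{f_a,H\}=0$ and $\{f_a,f_b\}=0$ on $U$ for all $a,b$, and such that the matrix $[\partial f_a/\partial p_j]$ is invertible at every point of $U$. The common kernel of $df_1,\dots,df_n$ is then a complement of the vertical subbundle of $T(T^*M)$ over $U$, that is, a nonlinear connection $\operatorname{Hor}$ on $U$, spanned by vector fields $H_i=\frac{\partial}{\partial x^i}-\Gamma_{ij}(x,p)\frac{\partial}{\partial p_j}$. Its linearization is the linear connection $D$ on the pullback of $T^*M$ to $U$ given by $$D_W\sigma=\kappa\bigl([P_{\mathsf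 H}(W),\sigma^{\mathsf V}]+T\sigma(P_{\mathsf V}(W))\bigr),$$ where $P_{\mathsf H},P_{\mathsf V}$ are the horizontal and vertical projections, $\sigma^{\mathsf V}$ is the vertical lift of $\sigma$, and $\kappa$ is the connector of $\operatorname{Hor}$ (in coordinates $D_{H_i}dx^k=\frac{\partial\Gamma_{ij}}{\partial p_k}dx^j$ and $D_{\partial/\partial p_i}dx^k=0$). Assume that $D$ is flat, i.e. $D_VD_W\sigma-D_WD_V\sigma-D_{[V,W]}\sigma=0$ for all vector fields $V,W$ and sections $\sigma$. Let $\nabla$ be the Levi-Civita connection of $g$, with Christoffel symbols $\{{}^k_{ij}\}$; coordinates on $M$ are called $\nabla$-affine if all these symbols vanish identically in them. Then: 1. $\operatorname{Hor}$ is linear on $U$ (that is, $\Gamma_{ij}(x,cp)=c\,\Gamma_{ij}(x,p)$ for $c\in\mathbb R$ whenever both points lie in $U$) and it equals the dual of $\nabla$: in all coordinates, $\Gamma_{ij}(x,p)=-\sum_k\{{}^k_{ij}\}(x)\,p_k$ on $U$. Moreover, every point of the projection of $U$ to $M$ lies in the domain of some $\nabla$-affine coordinates. 2. In any $\nabla$-affine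 coordinates $(x^i)$ with connected domain the Hamilton–Jacobi equation is separable: there are an open set $\Lambda\subseteq\mathbb R^n$ and smooth functions $S_i(x^i,\lambda)$ such that, with $S(x,\lambda)=\sum_iS_i(x^i,\lambda)$, for each $\lambda\in\Lambda$ the function $x\mapsto H\bigl(x,\frac{\partial S}{\partial x}(x,\lambda)\bigr)$ is constant, and this family of solutions is complete: for every $x$ in the coordinate range, $\lambda\mapsto\frac{\partial S}{\partial x}(x,\lambda)$ is a bijection of $\Lambda$ onto $(\mathbb R^n)^*$ with everywhere invertible derivative. 3. In any $\nabla$-affine coordinates all coordinates are ignorable: $\partial H/\partial x^i=0$ identically, for every $i$, in the induced canonical coordinates. -/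

import Mathlib

open scoped Manifold ContDiff

/-- The space `ℝⁿ` in which coordinate systems take their values. -/
abbrev Coord (n : ℕ) : Type := EuclideanSpace ℝ (Fin n)

/-- The space of covectors on `ℝⁿ`, in which the momenta take their values. -/
abbrev Momenta (n : ℕ) : Type := Coord n →L[ℝ] ℝ

/-- The cotangent bundle `T*M`, with Mathlib's topology and smooth structure. A point is a pair
`⟨x, p⟩` with `p : TangentSpace (𝓡 n) x →L[ℝ] ℝ`. -/
abbrev CotangentBundle (n : ℕ) (M : Type*) [TopologicalSpace M] [ChartedSpace (Coord n) M]
    [IsManifold (𝓡 n) ∞ M] : Type _ :=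
  Bundle.TotalSpace (Momenta n) (fun x : M => TangentSpace (𝓡 n) x →L[ℝ] Bundle.Trivial M ℝ x)

noncomputable section

namespace CotangentConnection

/-- The `i`-th vector of the standard basis of `ℝⁿ`. -/
def basisVec {n : ℕ} (i : Fin n) : Coord n := EuclideanSpace.single i 1

/-- The `i`-th vector `dxⁱ` of the dual basis. -/
def basisCovec {n : ℕ} (i : Fin n) : Momenta n := EuclideanSpace.proj i

/-! ### Calculus in the canonical coordinates `(x, p)`

Here `Γ` denotes the coefficients of a nonlinear connection in canonical coordinates: the
horizontal lift of `u` at `z = (x, p)` is `(u, -Γ z u)`, so that `Γ_{ij}(z) = Γ z eᵢ eⱼ` and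
`Hᵢ = ∂/∂xⁱ - Γ_{ij} ∂/∂pⱼ`. -/

section Coordinates

variable {n : ℕ}

theorem finrank_dual (V : Type*) [NormedAddCommGroup V] [NormedSpace ℝ V]
    [FiniteDimensional ℝ V] : Module.finrank ℝ (V →L[ℝ] ℝ) = Module.finrank ℝ V := by
  rw [← LinearEquiv.finrank_eq (LinearMap.toContinuousLinearMap (𝕜 := ℝ) (E := V) (F' := ℝ)),
    Module.finrank_linearMap, Module.finrank_self, mul_one]

theorem pi_injective {V : Type*} [NormedAddCommGroup V] [NormedSpace ℝ V]
    [FiniteDimensional ℝ V] (φ : Fin n → V →L[ℝ] ℝ) (hn : Module.finrank ℝ V = n)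
    (h : LinearIndependent ℝ φ) : Function.Injective (ContinuousLinearMap.pi φ) := by
  rw [injective_iff_map_eq_zero]
  intro v hv
  have hspan : Submodule.span ℝ (Set.range φ) = ⊤ :=
    h.span_eq_top_of_card_eq_finrank' (by rw [finrank_dual, hn, Fintype.card_fin])
  have hz : ∀ L : V →L[ℝ] ℝ, L v = 0 := by
    intro L
    have hmem : L ∈ Submodule.span ℝ (Set.range φ) := by rw [hspan]; trivial
    induction hmem using Submodule.span_induction with
    | mem x hx => obtain ⟨a, rfl⟩ := hx; exact congrFun hv a
    | zero => rfl
    | add x y _ _ hx hy => simp [hx, hy]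
    | smul c x _ hx => simp [hx]
  by_contra hne
  obtain ⟨L, -, hL⟩ := exists_dual_vector ℝ v (norm_ne_zero_iff.2 hne)
  rw [hz] at hL
  exact hne (norm_eq_zero.1 (by simpa using hL.symm))

/-- The canonical Poisson bracket
`{F, G} = ∑ᵢ (∂F/∂xⁱ ∂G/∂pᵢ - ∂G/∂xⁱ ∂F/∂pᵢ)`. -/
def poissonBracket (F G : Coord n × Momenta n → ℝ) (z : Coord n × Momenta n) : ℝ :=
  ∑ i, (fderiv ℝ F z (basisVec i, 0) * fderiv ℝ G z (0, basisCovec i)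
    - fderiv ℝ G z (basisVec i, 0) * fderiv ℝ F z (0, basisCovec i))

/-- The fibre derivative `dⱽF` of a function at `z`, an element of the dual of the space of
momenta. -/
def verticalDeriv (F : Coord n × Momenta n → ℝ) (z : Coord n × Momenta n) :
    Momenta n →L[ℝ] ℝ :=
  (fderiv ℝ F z).comp (ContinuousLinearMap.inr ℝ (Coord n) (Momenta n))

/-- The derivative of a function at `z` in the directions of `ℝⁿ`, the momenta being fixed. -/
def positionDeriv (F : Coord n × Momenta n → ℝ) (z : Coord n × Momenta n) :
    Coord n →L[ℝ] ℝ :=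
  (fderiv ℝ F z).comp (ContinuousLinearMap.inl ℝ (Coord n) (Momenta n))

/-- The coefficients `Γ` of the nonlinear connection whose horizontal distribution is the
annihilator of `dF₁, …, dFₙ`. They are determined by
`∂F_a/∂xⁱ - Γ_{ij} ∂F_a/∂pⱼ = 0`; see `mem_annihilator_iff`. -/
def annihilatorCoeff (F : Fin n → Coord n × Momenta n → ℝ) (z : Coord n × Momenta n) :
    Coord n →L[ℝ] Momenta n :=
  (ContinuousLinearMap.pi fun a => verticalDeriv (F a) z).inverse.comp
    (ContinuousLinearMap.pi fun a => positionDeriv (F a) z)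

/-- If `dⱽF₁, …, dⱽFₙ` are linearly independent at `z`, the common kernel of the differentials
`dF_a` at `z` is the space of the vectors `(u, -Γ u)`. -/
theorem mem_annihilator_iff (F : Fin n → Coord n × Momenta n → ℝ) (z : Coord n × Momenta n)
    (h : LinearIndependent ℝ fun a => verticalDeriv (F a) z) (u : Coord n) (η : Momenta n) :
    (∀ a, fderiv ℝ (F a) z (u, η) = 0) ↔ η = -annihilatorCoeff F z u := by
  set A : Momenta n →L[ℝ] (Fin n → ℝ) :=
    ContinuousLinearMap.pi fun a => verticalDeriv (F a) z with hA
  have hinj : Function.Injective A := by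
    exact pi_injective _ (by rw [finrank_dual, finrank_euclideanSpace_fin]) h
  have hdim : Module.finrank ℝ (Momenta n) = Module.finrank ℝ (Fin n → ℝ) := by
    rw [finrank_dual, finrank_euclideanSpace_fin, Module.finrank_fin_fun]
  obtain ⟨B, hB⟩ : ∃ B : Momenta n ≃L[ℝ] (Fin n → ℝ), (B : Momenta n →L[ℝ] (Fin n → ℝ)) = A :=
    ⟨(LinearEquiv.ofInjectiveOfFinrankEq A.toLinearMap hinj hdim).toContinuousLinearEquiv, by
      ext; rfl⟩
  have key : ∀ a, fderiv ℝ (F a) z (u, η) = positionDeriv (F a) z u + A η a := by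
    intro a
    have : ((u, η) : Coord n × Momenta n) = (u, 0) + (0, η) := by simp
    rw [this, map_add]
    rfl
  have hΓ : A (annihilatorCoeff F z u) = fun a => positionDeriv (F a) z u := by
    have : annihilatorCoeff F z u = A.inverse (fun a => positionDeriv (F a) z u) := rfl
    rw [this, ← hB, ContinuousLinearMap.inverse_equiv]
    simp
  constructor
  · intro hk
    apply hinj
    rw [map_neg, hΓ]
    ext a
    have := hk a
    rw [key] at this
    simp only [Pi.neg_apply]
    linarith
  · rintro rfl a
    rw [key, map_neg, hΓ]
    simp

variable (Γ : Coord n × Momenta n → Coord n →L[ℝ] Momenta n)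

/-- The connector `κ` at `z`. -/
def connector (z w : Coord n × Momenta n) : Momenta n := w.2 + Γ z w.1

/-- The horizontal projection `P_H(U)` of a vector field `U`. -/
def horProj (U : Coord n × Momenta n → Coord n × Momenta n) (z : Coord n × Momenta n) :
    Coord n × Momenta n := ((U z).1, -Γ z (U z).1)

/-- The vertical lift `σⱽ` of a 1-form `σ` along the projection. -/
def vertLift (σ : Coord n × Momenta n → Momenta n) (z : Coord n × Momenta n) :
    Coord n × Momenta n := (0, σ z)

/-- The vertical projection `P_V(U) = κ(U)ⱽ` of a vector field `U`. -/
def vertProj (U : Coord n × Momenta n → Coord n × Momenta n) :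
    Coord n × Momenta n → Coord n × Momenta n := vertLift fun z => connector Γ z (U z)

/-- The linearization of the nonlinear connection `Γ`: the covariant derivative
`D_U σ = κ([P_H(U), σⱽ]) + κ(Tσ(P_V(U)))` on the pullback of the cotangent bundle to itself.
Here `Tσ(P_V(U))` is the vertical vector with second component `dσ(P_V(U))`. -/
def linearization (U : Coord n × Momenta n → Coord n × Momenta n)
    (σ : Coord n × Momenta n → Momenta n) (z : Coord n × Momenta n) : Momenta n :=
  connector Γ z (VectorField.lieBracket ℝ (horProj Γ U) (vertLift σ) z
    + (0, fderiv ℝ σ z (vertProj Γ U z)))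

/-- The curvature `Curv(U, V)σ = [D_U, D_V]σ - D_{[U, V]}σ` of the linearization. -/
def curvature (U V : Coord n × Momenta n → Coord n × Momenta n)
    (σ : Coord n × Momenta n → Momenta n) (z : Coord n × Momenta n) : Momenta n :=
  linearization Γ U (linearization Γ V σ) z - linearization Γ V (linearization Γ U σ) z
    - linearization Γ (VectorField.lieBracket ℝ U V) σ z

/-- The linearization of `Γ` is flat on the open set `W`. -/
def IsFlatLinearizationOn (W : Set (Coord n × Momenta n)) : Prop :=
  ∀ (U V : Coord n × Momenta n → Coord n × Momenta n) (σ : Coord n × Momenta n → Momenta n),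
    ContDiffOn ℝ ∞ U W → ContDiffOn ℝ ∞ V W → ContDiffOn ℝ ∞ σ W →
      ∀ z ∈ W, curvature Γ U V σ z = 0

/-- The nonlinear connection `Γ` is linear on `W`: its horizontal lift `ξ` satisfies
`ξ(c p, v) = Tμ_c (ξ(p, v))`, where `μ_c` is multiplication by `c` in the fibres. -/
def IsLinearOn (W : Set (Coord n × Momenta n)) : Prop :=
  ∀ (x : Coord n) (p : Momenta n) (c : ℝ), (x, p) ∈ W → (x, c • p) ∈ W →
    Γ (x, c • p) = c • Γ (x, p)

end Coordinates

/-! ### Coordinate systems on `M` and on `T*M` -/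

section Manifold

variable {n : ℕ} {M : Type*} [TopologicalSpace M] [ChartedSpace (Coord n) M]
  [IsManifold (𝓡 n) ∞ M]

/-- The point of `T*M` with canonical coordinates `(x, p)` in the coordinate system `e` of `M`,
that is, the covector `∑ᵢ pᵢ dxⁱ` at the point with coordinates `x`. -/
def ofCanonical (e : OpenPartialHomeomorph M (Coord n)) (z : Coord n × Momenta n) :
    CotangentBundle n M :=
  ⟨e.symm z.1, z.2.comp (mfderiv (𝓡 n) (𝓡 n) e (e.symm z.1))⟩

/-- The expression of a function on `T*M` in the canonical coordinates induced by `e`. -/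
def inCanonical (e : OpenPartialHomeomorph M (Coord n)) (F : CotangentBundle n M → ℝ) :
    Coord n × Momenta n → ℝ := fun z => F (ofCanonical e z)

/-- The range of the canonical coordinates induced by `e` on the part of `U` over the domain
of `e`. -/
def canonicalDomain (e : OpenPartialHomeomorph M (Coord n)) (U : Set (CotangentBundle n M)) :
    Set (Coord n × Momenta n) := {z | z.1 ∈ e.target ∧ ofCanonical e z ∈ U}

/-- `F` and `G` Poisson commute on `U`. -/
def PoissonCommute (F G : CotangentBundle n M → ℝ) (U : Set (CotangentBundle n M)) : Prop :=
  ∀ e ∈ IsManifold.maximalAtlas (𝓡 n) ∞ M, ∀ z ∈ canonicalDomain e U,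
    poissonBracket (inCanonical e F) (inCanonical e G) z = 0

/-- `f₁, …, fₙ` are smooth first integrals of `H` in involution on the open set `U` of `T*M`,
with `dⱽf₁ ∧ … ∧ dⱽfₙ ≠ 0` at every point of `U`. -/
structure IsCompletelyIntegrableOn (H : CotangentBundle n M → ℝ)
    (f : Fin n → CotangentBundle n M → ℝ) (U : Set (CotangentBundle n M)) : Prop where
  isOpen : IsOpen U
  smooth : ∀ a, ContMDiffOn ((𝓡 n).prod 𝓘(ℝ, Momenta n)) 𝓘(ℝ, ℝ) ∞ (f a) U
  constant_of_motion : ∀ a, PoissonCommute (f a) H U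
  involution : ∀ a b, PoissonCommute (f a) (f b) U
  transversal : ∀ e ∈ IsManifold.maximalAtlas (𝓡 n) ∞ M, ∀ z ∈ canonicalDomain e U,
    LinearIndependent ℝ fun a => verticalDeriv (inCanonical e (f a)) z

/-- The coefficients, in the canonical coordinates induced by `e`, of the nonlinear connection
on `T*M` whose horizontal distribution is the annihilator of `df₁, …, dfₙ`. -/
def connCoeff (f : Fin n → CotangentBundle n M → ℝ) (e : OpenPartialHomeomorph M (Coord n)) :
    Coord n × Momenta n → Coord n →L[ℝ] Momenta n :=
  annihilatorCoeff fun a => inCanonical e (f a)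

/-- The linearization of the connection annihilating `df₁, …, dfₙ` is flat on `U`. -/
def HasFlatLinearization (f : Fin n → CotangentBundle n M → ℝ) (U : Set (CotangentBundle n M)) :
    Prop :=
  ∀ e ∈ IsManifold.maximalAtlas (𝓡 n) ∞ M,
    IsFlatLinearizationOn (connCoeff f e) (canonicalDomain e U)

/-- The connection annihilating `df₁, …, dfₙ` is linear on `U`. -/
def IsLinearConnection (f : Fin n → CotangentBundle n M → ℝ) (U : Set (CotangentBundle n M)) :
    Prop :=
  ∀ e ∈ IsManifold.maximalAtlas (𝓡 n) ∞ M, IsLinearOn (connCoeff f e) (canonicalDomain e U)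

/-- The coordinate vector `∂/∂xⁱ` of the coordinate system `e` at the point with
coordinates `x`. -/
def coordVec (e : OpenPartialHomeomorph M (Coord n)) (x : Coord n) (i : Fin n) :
    TangentSpace (𝓡 n) (e.symm x) :=
  mfderiv (𝓡 n) (𝓡 n) e.symm x (basisVec i)

/-- `S(x, c) = ∑ᵢ Sᵢ(xⁱ, c)`. -/
def separatedSum (S : Fin n → ℝ × Coord n → ℝ) (c x : Coord n) : ℝ := ∑ i, S i (x i, c)

/-- The Hamilton-Jacobi equation of `H` is separable in the coordinates `e`: it has a complete
solution `α_c = dS(·, c)`, `c ∈ Λ`, with `Λ` open in `ℝⁿ` and `S(x, c) = ∑ᵢ Sᵢ(xⁱ, c)`.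
Complete means that `(x, c) ↦ α_c(x)` is a diffeomorphism of `e.target × Λ` onto the cotangent
bundle of the domain of `e`; equivalently, for every `x`, the map `c ↦ α_c(x)` is a bijection of
`Λ` onto the space of momenta with invertible derivative `∂²S/∂c∂x`. -/
def HamiltonJacobiSeparable (H : CotangentBundle n M → ℝ)
    (e : OpenPartialHomeomorph M (Coord n)) : Prop :=
  ∃ (Λ : Set (Coord n)) (S : Fin n → ℝ × Coord n → ℝ), IsOpen Λ ∧
    (∀ i, ContDiffOn ℝ ∞ (S i) (((fun x : Coord n => x i) '' e.target) ×ˢ Λ)) ∧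
    (∀ c ∈ Λ, ∃ k : ℝ, ∀ x ∈ e.target,
      inCanonical e H (x, fderiv ℝ (separatedSum S c) x) = k) ∧
    (∀ x ∈ e.target,
      Set.BijOn (fun c => fderiv ℝ (separatedSum S c) x) Λ Set.univ ∧
      ∀ c ∈ Λ, Function.Bijective (fderiv ℝ (fun c' => fderiv ℝ (separatedSum S c') x) c))

/-- The `i`-th coordinate of `e` is ignorable for `H`: in the canonical coordinates induced by
`e`, `∂H/∂xⁱ` exists and vanishes identically. -/
def IsIgnorable (H : CotangentBundle n M → ℝ) (e : OpenPartialHomeomorph M (Coord n))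
    (i : Fin n) : Prop :=
  ∀ x ∈ e.target, ∀ p : Momenta n,
    HasDerivAt (fun t : ℝ => inCanonical e H (x + t • basisVec i, p)) 0 0

end Manifold

end CotangentConnection

/-! ### Pseudo-Riemannian metrics -/

/-- A smooth pseudo-Riemannian metric on `M`. -/
structure PseudoRiemannianMetric (n : ℕ) (M : Type*) [TopologicalSpace M]
    [ChartedSpace (Coord n) M] [IsManifold (𝓡 n) ∞ M] where
  val (x : M) : TangentSpace (𝓡 n) x →L[ℝ] TangentSpace (𝓡 n) x →L[ℝ] ℝ
  symm (x : M) (v w : TangentSpace (𝓡 n) x) : val x v w = val x w v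
  nondegenerate (x : M) (v : TangentSpace (𝓡 n) x) : (∀ w, val x v w = 0) → v = 0
  contMDiff : ContMDiff (𝓡 n) ((𝓡 n).prod 𝓘(ℝ, Coord n →L[ℝ] Coord n →L[ℝ] ℝ)) ∞
    (fun x => Bundle.TotalSpace.mk' (Coord n →L[ℝ] Coord n →L[ℝ] ℝ)
      (E := fun x : M => TangentSpace (𝓡 n) x →L[ℝ] TangentSpace (𝓡 n) x →L[ℝ] ℝ) x (val x))

namespace PseudoRiemannianMetric

open CotangentConnection

variable {n : ℕ} {M : Type*} [TopologicalSpace M] [ChartedSpace (Coord n) M]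
  [IsManifold (𝓡 n) ∞ M] (g : PseudoRiemannianMetric n M)

theorem val_bijective (x : M) : Function.Bijective (g.val x) := by
  have hinj : Function.Injective (g.val x) := by
    rw [injective_iff_map_eq_zero]
    intro v hv
    exact g.nondegenerate x v fun w => by rw [hv]; rfl
  let b : Coord n →L[ℝ] Momenta n := show Coord n →L[ℝ] Coord n →L[ℝ] ℝ from g.val x
  have hdim : Module.finrank ℝ (Coord n) = Module.finrank ℝ (Momenta n) := (finrank_dual _).symm
  exact ⟨hinj, (LinearMap.injective_iff_surjective_of_finrank_eq_finrank
    (f := (b : Coord n →ₗ[ℝ] Momenta n)) hdim).1 hinj⟩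

/-- The vector `g⁻¹(p)`: the unique `v` with `g(v, ·) = p`. -/
def sharp (x : M) (p : TangentSpace (𝓡 n) x →L[ℝ] ℝ) : TangentSpace (𝓡 n) x :=
  Function.surjInv (g.val_bijective x).2 p

/-- The geodesic Hamiltonian `H(p) = ½ G(p, p)`, with `G = g⁻¹` the inverse metric on `T*M`,
`G(p, q) = p(g⁻¹(q))`. -/
def geodesicHamiltonian (q : CotangentBundle n M) : ℝ := 1 / 2 * q.2 (g.sharp q.1 q.2)

/-- The matrix `g_{ij}(x)` of the metric in the coordinates `e`. -/
def gram (e : OpenPartialHomeomorph M (Coord n)) (x : Coord n) : Matrix (Fin n) (Fin n) ℝ :=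
  Matrix.of fun i j => g.val (e.symm x) (coordVec e x i) (coordVec e x j)

/-- The partial derivative `∂g_{jl}/∂xⁱ`. -/
def gramDeriv (e : OpenPartialHomeomorph M (Coord n)) (x : Coord n) (i j l : Fin n) : ℝ :=
  fderiv ℝ (fun y => g.gram e y j l) x (basisVec i)

/-- The Christoffel symbols of the Levi-Civita connection `∇` of `g` in the coordinates `e`,
`{k; ij} = ½ gᵏˡ (∂ᵢ g_{jl} + ∂ⱼ g_{il} - ∂ₗ g_{ij})`, so that
`∇_{∂ᵢ} ∂ⱼ = {k; ij} ∂ₖ`. -/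
def christoffel (e : OpenPartialHomeomorph M (Coord n)) (x : Coord n) (k i j : Fin n) : ℝ :=
  1 / 2 * ∑ l, (g.gram e x)⁻¹ k l *
    (g.gramDeriv e x i j l + g.gramDeriv e x j i l - g.gramDeriv e x l i j)

/-- The coefficients `Γ_{ij}(x, p) = -{k; ij}(x) pₖ` of the dual of the Levi-Civita connection,
the linear connection on `T*M` given by `∇_{∂ᵢ} dxᵏ = -{k; ij} dxʲ`. -/
def dualLeviCivitaCoeff (e : OpenPartialHomeomorph M (Coord n)) (z : Coord n × Momenta n)
    (i j : Fin n) : ℝ :=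
  -∑ k, g.christoffel e z.1 k i j * z.2 (basisVec k)

/-- On `U`, the connection on `T*M` annihilating `df₁, …, dfₙ` is the dual of the Levi-Civita
connection of `g`. -/
def EqDualLeviCivita (f : Fin n → CotangentBundle n M → ℝ) (U : Set (CotangentBundle n M)) :
    Prop :=
  ∀ e ∈ IsManifold.maximalAtlas (𝓡 n) ∞ M, ∀ z ∈ canonicalDomain e U, ∀ i j : Fin n,
    connCoeff f e z (basisVec i) (basisVec j) = g.dualLeviCivitaCoeff e z i j

/-- A coordinate system of `M` is `∇`-affine if the Christoffel symbols of `∇` vanish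
identically in it. -/
def IsAffineChart (e : OpenPartialHomeomorph M (Coord n)) : Prop :=
  e ∈ IsManifold.maximalAtlas (𝓡 n) ∞ M ∧ ∀ x ∈ e.target, ∀ k i j, g.christoffel e x k i j = 0

end PseudoRiemannianMetric

end

noncomputable section

namespace CotangentConnection

/-! ### The connection annihilating functions in involution, in canonical coordinates -/

section AnnihilatorCoordinates

variable {n : ℕ}

/-! Involution of the $f_a$ says that their common kernel is Lagrangian, so $\Gamma_{ij}$ is
symmetric (`annihilatorCoeff_symm`). A function in involution with all the $f_a$ is then constant
along this kernel (`positionDeriv_eq_of_involution`). For $H$ this is the energy identity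
$\tfrac12\,p(\partial_uG\,p)=\Gamma(p)_u(Gp)$.

Evaluated on a vertical and a coordinate direction, flatness of $D$ gives $\partial^2\Gamma/\partial
p\,\partial p=0$ (`fderiv_fderiv_eq_zero_of_isFlatLinearizationOn`). With $\Gamma$ affine in $p$,
the energy identity is polynomial on a neighbourhood of each point of the fibre. Its quadratic part
says that $\partial\Gamma/\partial p$ is compatible with the metric, and its linear part says that
$\Gamma$ has no constant term (`energy_identity_coefficients`). Compatibility together with symmetry
determines the Levi-Civita connection by the Koszul argument (`coeff_of_isFlatLinearizationOn`,
`eqDualLeviCivita`).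

For affine coordinates, the level sets of the $f_a$ are locally graphs of parallel 1-forms, closed
because $\Gamma$ is symmetric. Choosing $n$ of them independent at a point and integrating gives
coordinates $y^k$ (`exists_parallel_coordinates`). Each $f_a$ is constant along $dy^k$, so $\Gamma$
vanishes there, and by the formula for $\Gamma$ so do all the Christoffel symbols
(`exists_isAffineChart`).

In affine coordinates the $g_{ij}$ are locally constant, so $H$ depends on $p$ alone. Every
coordinate is ignorable, and over a connected domain $S=\sum_i c_ix^i$ is a complete separated
solution. -/

theorem coord_eq_sum (v : Coord n) : v = ∑ i, v i • basisVec i := by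
  ext j
  simp [basisVec, Finset.sum_apply, Pi.single_apply]

theorem momenta_apply_eq_sum (p : Momenta n) (v : Coord n) :
    p v = ∑ i, v i * p (basisVec i) := by
  conv_lhs => rw [coord_eq_sum v]
  simp

theorem momenta_eq_sum (p : Momenta n) : p = ∑ i, p (basisVec i) • basisCovec i := by
  ext v
  rw [momenta_apply_eq_sum]
  simp [basisCovec, mul_comm]

/-- The vector corresponding to a linear form on the space of momenta. -/
def vecOfForm : (Momenta n →L[ℝ] ℝ) →ₗ[ℝ] Coord n where
  toFun L := ∑ i, L (basisCovec i) • basisVec i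
  map_add' L L' := by simp only [add_apply, add_smul, Finset.sum_add_distrib]
  map_smul' c L := by simp only [smul_apply, smul_assoc, Finset.smul_sum, RingHom.id_apply]

theorem apply_vecOfForm (L : Momenta n →L[ℝ] ℝ) (p : Momenta n) : p (vecOfForm L) = L p := by
  conv_rhs => rw [momenta_eq_sum p]
  simp [vecOfForm, mul_comm]

theorem exists_vecOfForm_eq (v : Coord n) : ∃ L : Momenta n →L[ℝ] ℝ, vecOfForm L = v := by
  refine ⟨ContinuousLinearMap.apply ℝ ℝ v, ?_⟩
  conv_rhs => rw [coord_eq_sum v]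
  simp [vecOfForm, basisCovec]

/-- Basis-free form of the bracket: through the identification of the bidual with `Coord n`, fibre
derivatives become vectors to which position derivatives apply. -/
theorem poissonBracket_eq (F G : Coord n × Momenta n → ℝ) (z : Coord n × Momenta n) :
    poissonBracket F G z = positionDeriv F z (vecOfForm (verticalDeriv G z))
      - positionDeriv G z (vecOfForm (verticalDeriv F z)) := by
  simp [poissonBracket, vecOfForm, positionDeriv, verticalDeriv, mul_comm]

theorem span_range_dual_eq_top {V : Type*} [NormedAddCommGroup V] [NormedSpace ℝ V]
    [FiniteDimensional ℝ V] (φ : Fin n → V →L[ℝ] ℝ) (hn : Module.finrank ℝ V = n)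
    (h : LinearIndependent ℝ φ) : Submodule.span ℝ (Set.range φ) = ⊤ :=
  h.span_eq_top_of_card_eq_finrank' (by rw [finrank_dual, hn, Fintype.card_fin])

/-- A linear form vanishing on the vectors of a basis of the bidual vanishes. -/
theorem eq_zero_of_forall_vecOfForm {V : Fin n → Momenta n →L[ℝ] ℝ} (hV : LinearIndependent ℝ V)
    (φ : Coord n →ₗ[ℝ] ℝ) (h : ∀ a, φ (vecOfForm (V a)) = 0) : φ = 0 := by
  have hspan : Submodule.span ℝ (Set.range V) = ⊤ :=
    span_range_dual_eq_top V (by rw [finrank_dual, finrank_euclideanSpace_fin]) hV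
  have h1 : φ ∘ₗ vecOfForm = 0 := by
    refine LinearMap.ext_on_range (v := V) hspan fun a => ?_
    simpa using h a
  refine LinearMap.ext fun v => ?_
  obtain ⟨L, rfl⟩ := exists_vecOfForm_eq v
  exact LinearMap.congr_fun h1 L

variable {F : Fin n → Coord n × Momenta n → ℝ} {z : Coord n × Momenta n}

theorem positionDeriv_eq_verticalDeriv (h : LinearIndependent ℝ fun a => verticalDeriv (F a) z)
    (a : Fin n) (u : Coord n) :
    positionDeriv (F a) z u = verticalDeriv (F a) z (annihilatorCoeff F z u) := by
  have h1 := (mem_annihilator_iff F z h u _).2 rfl a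
  have h2 : ((u, -annihilatorCoeff F z u) : Coord n × Momenta n)
      = (u, 0) - (0, annihilatorCoeff F z u) := by simp
  rw [h2, map_sub, sub_eq_zero] at h1
  exact h1

/-- The connection annihilating functions in involution is Lagrangian. -/
theorem annihilatorCoeff_symm (h : LinearIndependent ℝ fun a => verticalDeriv (F a) z)
    (hinv : ∀ a b, poissonBracket (F a) (F b) z = 0) (u v : Coord n) :
    annihilatorCoeff F z u v = annihilatorCoeff F z v u := by
  set Γ := annihilatorCoeff F z with hΓ
  let β : Coord n →ₗ[ℝ] Coord n →ₗ[ℝ] ℝ := LinearMap.mk₂ ℝ (fun u v => Γ u v - Γ v u)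
    (by intro a b c; simp only [map_add, add_apply]; ring)
    (by intro c a b; simp only [map_smul, smul_apply, smul_eq_mul]; ring)
    (by intro a b c; simp only [map_add, add_apply]; ring)
    (by intro c a b; simp only [map_smul, smul_apply, smul_eq_mul]; ring)
  -- On the basis of vectors attached to the fibre derivatives, the skew part of `Γ` is exactly the
  -- matrix of Poisson brackets.
  have h1 : ∀ a b, β (vecOfForm (verticalDeriv (F a) z)) (vecOfForm (verticalDeriv (F b) z))
      = 0 := by
    intro a b
    have := hinv b a
    rw [poissonBracket_eq, positionDeriv_eq_verticalDeriv h, positionDeriv_eq_verticalDeriv h,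
      ← apply_vecOfForm, ← apply_vecOfForm] at this
    exact this
  have h2 : ∀ a, β (vecOfForm (verticalDeriv (F a) z)) = 0 := fun a =>
    eq_zero_of_forall_vecOfForm h _ (h1 a)
  have h3 : β.flip v = 0 := eq_zero_of_forall_vecOfForm h _ fun a => by
    rw [LinearMap.flip_apply, h2]; rfl
  have h4 : β u v = 0 := LinearMap.congr_fun h3 u
  exact sub_eq_zero.1 h4

/-- A function in involution with the `F_a` is constant along the connection annihilating them. -/
theorem positionDeriv_eq_of_involution (h : LinearIndependent ℝ fun a => verticalDeriv (F a) z)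
    (hinv : ∀ a b, poissonBracket (F a) (F b) z = 0) {H : Coord n × Momenta n → ℝ}
    (hH : ∀ a, poissonBracket (F a) H z = 0) (u : Coord n) :
    positionDeriv H z u = verticalDeriv H z (annihilatorCoeff F z u) := by
  -- The form is the derivative of `H` along the horizontal lift. Symmetry of `Γ` turns its value on
  -- the `a`-th basis vector into the bracket of `F a` with `H`, up to sign.
  have := eq_zero_of_forall_vecOfForm h
    ((positionDeriv H z - (verticalDeriv H z).comp (annihilatorCoeff F z) :
      Coord n →L[ℝ] ℝ) : Coord n →ₗ[ℝ] ℝ) fun a => by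
    have h1 := hH a
    rw [poissonBracket_eq, positionDeriv_eq_verticalDeriv h, ← apply_vecOfForm,
      annihilatorCoeff_symm h hinv, apply_vecOfForm] at h1
    simp only [ContinuousLinearMap.coe_coe, sub_apply,
      ContinuousLinearMap.comp_apply]
    linarith
  have := LinearMap.congr_fun this u
  simpa [sub_eq_zero] using this

theorem isInvertible_pi_verticalDeriv (h : LinearIndependent ℝ fun a => verticalDeriv (F a) z) :
    (ContinuousLinearMap.pi fun a => verticalDeriv (F a) z).IsInvertible := by
  have hinj := pi_injective _ (by rw [finrank_dual, finrank_euclideanSpace_fin]) h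
  exact ⟨(LinearEquiv.ofInjectiveOfFinrankEq
    (ContinuousLinearMap.pi fun a => verticalDeriv (F a) z).toLinearMap hinj
    (by rw [finrank_dual, finrank_euclideanSpace_fin, Module.finrank_fin_fun])).toContinuousLinearEquiv,
    by ext; rfl⟩

theorem contDiffAt_annihilatorCoeff (h : LinearIndependent ℝ fun a => verticalDeriv (F a) z)
    (hF : ∀ a, ContDiffAt ℝ ∞ (F a) z) : ContDiffAt ℝ ∞ (annihilatorCoeff F) z := by
  have hd : ∀ a, ContDiffAt ℝ ∞ (fderiv ℝ (F a)) z := fun a =>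
    (hF a).fderiv_right (m := ∞) (by simp)
  have key : ∀ (V : Type) [NormedAddCommGroup V] [NormedSpace ℝ V]
      (L : Fin n → Coord n × Momenta n → V →L[ℝ] ℝ), (∀ a, ContDiffAt ℝ ∞ (L a) z) →
      ContDiffAt ℝ ∞ (fun y => ContinuousLinearMap.pi fun a => L a y) z := by
    intro V _ _ L hL
    -- Written as a finite sum of compositions, the tuple of forms is smooth because each component
    -- is.
    have : (fun y => ContinuousLinearMap.pi fun a => L a y)
        = fun y => ∑ a, (ContinuousLinearMap.single ℝ (fun _ : Fin n => ℝ) a).comp (L a y) := by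
      ext y v a
      simp [Finset.sum_apply, Pi.single_apply]
    rw [this]
    exact ContDiffAt.sum fun a _ => contDiffAt_const.clm_comp (hL a)
  have hV : ContDiffAt ℝ ∞ (fun y => ContinuousLinearMap.pi fun a => verticalDeriv (F a) y) z :=
    key _ _ fun a => (hd a).clm_comp contDiffAt_const
  have hP : ContDiffAt ℝ ∞ (fun y => ContinuousLinearMap.pi fun a => positionDeriv (F a) y) z :=
    key _ _ fun a => (hd a).clm_comp contDiffAt_const
  obtain ⟨B, hB⟩ := isInvertible_pi_verticalDeriv h
  have hI : ContDiffAt ℝ ∞ (fun y => (ContinuousLinearMap.pi fun a =>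
      verticalDeriv (F a) y).inverse) z := by
    refine ContDiffAt.comp z (g := ContinuousLinearMap.inverse) ?_ hV
    rw [← hB]
    exact contDiffAt_map_inverse B
  exact hI.clm_comp hP

/-- The coefficients of a connection with flat linearization are affine along the fibres. -/
theorem fderiv_fderiv_eq_zero_of_isFlatLinearizationOn
    {Γ : Coord n × Momenta n → Coord n →L[ℝ] Momenta n} {W : Set (Coord n × Momenta n)}
    (hW : IsOpen W) (hΓ : ContDiffOn ℝ ∞ Γ W) (hflat : IsFlatLinearizationOn Γ W)
    (hz : z ∈ W) (u : Coord n) (s q : Momenta n) :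
    fderiv ℝ (fun y => fderiv ℝ Γ y (0, s) u) z (0, q) = 0 := by
  -- Constant fields and a constant section suffice: the fields commute, and `s` is parallel in the
  -- vertical direction, so only the vertical derivative of $D_{(u,0)}s=\partial_s\Gamma\,u$
  -- survives in the curvature.
  have h0 := hflat (fun _ => (0, q)) (fun _ => (u, 0)) (fun _ => s) contDiffOn_const
    contDiffOn_const contDiffOn_const z hz
  have hvert : ∀ (σ : Coord n × Momenta n → Momenta n) y,
      linearization Γ (fun _ => (0, q)) σ y = fderiv ℝ σ y (0, q) := by
    intro σ y
    have : horProj Γ (fun _ => ((0 : Coord n), q)) = fun _ => 0 := by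
      ext y <;> simp [horProj]
    simp [linearization, connector, VectorField.lieBracket, vertProj, vertLift, this]
  have hhor : ∀ y ∈ W, linearization Γ (fun _ => (u, 0)) (fun _ => s) y
      = fderiv ℝ Γ y (0, s) u := by
    intro y hy
    have hd : DifferentiableAt ℝ Γ y :=
      ((hΓ.contDiffAt (hW.mem_nhds hy)).differentiableAt (by simp))
    have h1 : HasFDerivAt (horProj Γ fun _ => (u, (0 : Momenta n)))
        ((0 : Coord n × Momenta n →L[ℝ] Coord n).prod
          (-((ContinuousLinearMap.apply ℝ (Momenta n) u).comp (fderiv ℝ Γ y)))) y := by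
      have := (ContinuousLinearMap.apply ℝ (Momenta n) u |>.hasFDerivAt (x := Γ y)
        |>.comp (f := Γ) y hd.hasFDerivAt).neg
      exact (hasFDerivAt_const u y).prodMk this
    have h2 : vertLift (fun _ => s) = fun _ : Coord n × Momenta n => ((0 : Coord n), s) := rfl
    simp [linearization, connector, VectorField.lieBracket, h1.fderiv, h2]
  have hbr : VectorField.lieBracket ℝ (fun _ => ((0 : Coord n), q))
      (fun _ : Coord n × Momenta n => (u, (0 : Momenta n))) = fun _ => 0 := by
    ext y <;> simp [VectorField.lieBracket]
  have hz0 : linearization Γ (fun _ => (0, q)) (fun _ => s) = fun _ => 0 := by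
    ext1 y; rw [hvert]; simp
  have hzero : ∀ y, linearization Γ (fun _ => (u, 0)) (fun _ => 0) y = 0 := by
    intro y
    have : vertLift (fun _ : Coord n × Momenta n => (0 : Momenta n)) = fun _ => 0 := by
      ext y <;> simp [vertLift]
    simp [linearization, connector, VectorField.lieBracket, this]
  have hzero' : linearization Γ (fun _ => 0) (fun _ => s) z = 0 := by
    have : horProj Γ (fun _ => 0) = fun _ => 0 := by
      ext y <;> simp [horProj]
    simp [linearization, connector, VectorField.lieBracket, this]
  rw [curvature, hbr, hz0, hzero, hzero', hvert] at h0
  have he : linearization Γ (fun _ => (u, 0)) (fun _ => s)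
      =ᶠ[nhds z] fun y => fderiv ℝ Γ y (0, s) u :=
    Filter.eventuallyEq_of_mem (hW.mem_nhds hz) hhor
  rw [he.fderiv_eq] at h0
  simpa using h0

end AnnihilatorCoordinates

end CotangentConnection

namespace CotangentConnection

/-! ### The connection of an integrable geodesic Hamiltonian, in canonical coordinates -/

section MetricCoordinates

/-- Comparison of the Taylor coefficients at `p` in the identity `½ η(A η) = γ(η)(G η)`, for a
map `γ` with vanishing second derivative at `p`. -/
theorem energy_identity_coefficients {V : Type*} [NormedAddCommGroup V] [NormedSpace ℝ V]
    {A G : (V →L[ℝ] ℝ) →L[ℝ] V} (hA : ∀ p q : V →L[ℝ] ℝ, p (A q) = q (A p))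
    {N : Set (V →L[ℝ] ℝ)} (hN : IsOpen N) {γ : (V →L[ℝ] ℝ) → V →L[ℝ] ℝ}
    {D : (V →L[ℝ] ℝ) → (V →L[ℝ] ℝ) →L[ℝ] V →L[ℝ] ℝ} (hγ : ∀ η ∈ N, HasFDerivAt γ (D η) η)
    (heq : ∀ η ∈ N, 1 / 2 * η (A η) = γ η (G η)) {p : V →L[ℝ] ℝ} (hp : p ∈ N)
    (hD : ∀ s, HasFDerivAt (fun η => D η s) (0 : (V →L[ℝ] ℝ) →L[ℝ] V →L[ℝ] ℝ) p) :
    (∀ s q, q (A s) = D p s (G q) + D p q (G s)) ∧ ∀ s, γ p (G s) = D p p (G s) := by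
  -- First derivative in the direction `s`; the symmetry of `A` merges the two terms on the left.
  have h1 : ∀ s, ∀ η ∈ N, η (A s) = D η s (G η) + γ η (G s) := by
    intro s η hη
    have hl := ((hasFDerivAt_id η).clm_apply (A.hasFDerivAt (x := η))).const_mul (1 / 2 : ℝ)
    have hr := (hγ η hη).clm_apply (G.hasFDerivAt (x := η))
    have he := hl.unique (hr.congr_of_eventuallyEq
      (Filter.eventuallyEq_of_mem (hN.mem_nhds hη) heq))
    have := DFunLike.congr_fun he s
    simp at this
    have h2 := hA s η
    linarith
  -- Second derivative, at `p` only, where `D` is stationary. Setting `q = p` and subtracting the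
  -- first-order identity isolates the constant part of `γ`.
  have h3 : ∀ s q, q (A s) = D p s (G q) + D p q (G s) := by
    intro s q
    have hl := (hasFDerivAt_id p).clm_apply (hasFDerivAt_const (A s) p)
    have hr := ((hD s).clm_apply (G.hasFDerivAt (x := p))).add
      ((hγ p hp).clm_apply (hasFDerivAt_const (G s) p))
    have he := hl.unique (hr.congr_of_eventuallyEq
      (Filter.eventuallyEq_of_mem (hN.mem_nhds hp) (h1 s)))
    have := DFunLike.congr_fun he q
    simpa using this
  refine ⟨h3, fun s => ?_⟩
  have := h1 s p hp
  rw [h3 s p] at this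
  linarith

variable {n : ℕ} {Ω : Set (Coord n)} {b : Coord n → Coord n →L[ℝ] Momenta n}

/-- The Hamiltonian `½ G(p, p)` for the inverse `G` of the metric `b`. -/
def metricHamiltonian (b : Coord n → Coord n →L[ℝ] Momenta n) (z : Coord n × Momenta n) : ℝ :=
  1 / 2 * z.2 ((b z.1).inverse z.2)

theorem inverse_symm {B : Coord n →L[ℝ] Momenta n} (hB : B.IsInvertible)
    (hsymm : ∀ v w, B v w = B w v) (p q : Momenta n) : p (B.inverse q) = q (B.inverse p) := by
  obtain ⟨p, rfl⟩ := hB.bijective.2 p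
  obtain ⟨q, rfl⟩ := hB.bijective.2 q
  rw [hB.inverse_apply_self, hB.inverse_apply_self, hsymm]

theorem contDiffAt_inverse_of_isInvertible {x : Coord n} (hb : ContDiffAt ℝ ∞ b x)
    (hinv : (b x).IsInvertible) : ContDiffAt ℝ ∞ (fun y => (b y).inverse) x := by
  obtain ⟨B, hB⟩ := hinv
  refine ContDiffAt.comp x (g := ContinuousLinearMap.inverse) ?_ hb
  rw [← hB]
  exact contDiffAt_map_inverse B

variable (hΩ : IsOpen Ω) (hb : ContDiffOn ℝ ∞ b Ω) (hsymm : ∀ x ∈ Ω, ∀ v w, b x v w = b x w v)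
  (hinv : ∀ x ∈ Ω, (b x).IsInvertible)

include hΩ hb hinv in
theorem hasFDerivAt_inverse_metric {x : Coord n} (hx : x ∈ Ω) :
    HasFDerivAt (fun y => (b y).inverse) (fderiv ℝ (fun y => (b y).inverse) x) x :=
  ((contDiffAt_inverse_of_isInvertible (hb.contDiffAt (hΩ.mem_nhds hx))
    (hinv x hx)).differentiableAt (by simp)).hasFDerivAt

include hΩ hb hinv in
-- This is $\partial(b^{-1})\,b=-b^{-1}\,\partial b$, from differentiating $b^{-1}bv=v$. It turns
-- derivatives of the inverse metric into derivatives of the metric.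
theorem fderiv_inverse_metric_apply {x : Coord n} (hx : x ∈ Ω) (u v : Coord n) :
    fderiv ℝ (fun y => (b y).inverse) x u (b x v) = -(b x).inverse (fderiv ℝ b x u v) := by
  have hd := ((hb.contDiffAt (hΩ.mem_nhds hx)).differentiableAt (by simp)).hasFDerivAt
  have h1 := (hasFDerivAt_inverse_metric hΩ hb hinv hx).clm_apply
    (hd.clm_apply (hasFDerivAt_const v x))
  have h2 := h1.unique ((hasFDerivAt_const v x).congr_of_eventuallyEq
    (Filter.eventuallyEq_of_mem (hΩ.mem_nhds hx) fun y hy => (hinv y hy).inverse_apply_self v))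
  have := DFunLike.congr_fun h2 u
  simp at this
  exact eq_neg_of_add_eq_zero_right this

include hΩ hb hsymm hinv in
theorem fderiv_inverse_metric_symm {x : Coord n} (hx : x ∈ Ω) (u : Coord n) (p q : Momenta n) :
    p (fderiv ℝ (fun y => (b y).inverse) x u q) = q (fderiv ℝ (fun y => (b y).inverse) x u p) := by
  have hd := hasFDerivAt_inverse_metric hΩ hb hinv hx
  have h1 : ∀ p q : Momenta n, HasFDerivAt (fun y => p ((b y).inverse q)) _ x := fun p q =>
    (hasFDerivAt_const p x).clm_apply (hd.clm_apply (hasFDerivAt_const q x))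
  have h2 := (h1 p q).unique ((h1 q p).congr_of_eventuallyEq
    (Filter.eventuallyEq_of_mem (hΩ.mem_nhds hx) fun y hy =>
      inverse_symm (hinv y hy) (hsymm y hy) p q))
  have := DFunLike.congr_fun h2 u
  simpa using this

include hΩ hb hsymm hinv in
theorem hasFDerivAt_metricHamiltonian {z : Coord n × Momenta n} (hz : z.1 ∈ Ω) :
    (∀ u, positionDeriv (metricHamiltonian b) z u
      = 1 / 2 * z.2 (fderiv ℝ (fun y => (b y).inverse) z.1 u z.2)) ∧
    ∀ η, verticalDeriv (metricHamiltonian b) z η = η ((b z.1).inverse z.2) := by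
  have hfst : HasFDerivAt (fun y : Coord n × Momenta n => y.1)
      (ContinuousLinearMap.fst ℝ (Coord n) (Momenta n)) z := hasFDerivAt_fst
  have hd : HasFDerivAt (fun y : Coord n × Momenta n => (b y.1).inverse)
      ((fderiv ℝ (fun y => (b y).inverse) z.1).comp (ContinuousLinearMap.fst ℝ _ _)) z :=
    HasFDerivAt.comp (g := fun y => (b y).inverse) z (hasFDerivAt_inverse_metric hΩ hb hinv hz)
      hfst
  have h1 : HasFDerivAt (metricHamiltonian b) _ z :=
    ((hasFDerivAt_snd (p := z)).clm_apply (hd.clm_apply (hasFDerivAt_snd (p := z)))).const_mul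
      (1 / 2 : ℝ)
  constructor
  · intro u
    simp [positionDeriv, h1.fderiv]
  · intro η
    have := inverse_symm (hinv _ hz) (hsymm _ hz) z.2 η
    simp [verticalDeriv, h1.fderiv, this]
    ring

variable {Γ : Coord n × Momenta n → Coord n →L[ℝ] Momenta n} {W : Set (Coord n × Momenta n)}

include hΩ hb hsymm hinv in
/-- A Lagrangian connection along which the Hamiltonian of the metric `b` is constant, with flat
linearization, is given by the Christoffel symbols (of the first kind) of `b`. -/
theorem coeff_of_isFlatLinearizationOn (hW : IsOpen W) (hWΩ : ∀ z ∈ W, z.1 ∈ Ω)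
    (hΓ : ContDiffOn ℝ ∞ Γ W) (hΓsymm : ∀ z ∈ W, ∀ u v, Γ z u v = Γ z v u)
    (hH : ∀ z ∈ W, ∀ u, positionDeriv (metricHamiltonian b) z u
      = verticalDeriv (metricHamiltonian b) z (Γ z u))
    (hflat : IsFlatLinearizationOn Γ W) {z : Coord n × Momenta n} (hz : z ∈ W) :
    ∃ C : Momenta n →L[ℝ] Coord n →L[ℝ] Momenta n, Γ z = C z.2 ∧
      ∀ u v w, fderiv ℝ b z.1 u v w + fderiv ℝ b z.1 v u w - fderiv ℝ b z.1 w u v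
        = -2 * C (b z.1 w) u v := by
  obtain ⟨x, p⟩ := z
  have hx : x ∈ Ω := hWΩ _ hz
  have hdΓ : ∀ y ∈ W, HasFDerivAt Γ (fderiv ℝ Γ y) y := fun y hy =>
    ((hΓ.contDiffAt (hW.mem_nhds hy)).differentiableAt (by simp)).hasFDerivAt
  have hincl : ∀ η : Momenta n, HasFDerivAt (fun η => ((x, η) : Coord n × Momenta n))
      (ContinuousLinearMap.inr ℝ (Coord n) (Momenta n)) η := fun η =>
    hasFDerivAt_prodMk_right x η
  set C : Momenta n →L[ℝ] Coord n →L[ℝ] Momenta n :=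
    (fderiv ℝ Γ (x, p)).comp (ContinuousLinearMap.inr ℝ (Coord n) (Momenta n)) with hC
  have hN : IsOpen {η | (x, η) ∈ W} := hW.preimage (by fun_prop : Continuous fun η => (x, η))
  -- The energy identity on the fibre over `x`, with `A` the derivative of the inverse metric along
  -- `u` and `G` the inverse metric.
  have key : ∀ u : Coord n,
      (∀ s q : Momenta n, q (fderiv ℝ (fun y => (b y).inverse) x u s)
        = C s u ((b x).inverse q) + C q u ((b x).inverse s)) ∧
      ∀ s, Γ (x, p) u ((b x).inverse s) = C p u ((b x).inverse s) := by
    intro u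
    refine energy_identity_coefficients (V := Coord n) (N := {η | (x, η) ∈ W})
      (γ := fun η => Γ (x, η) u)
      (D := fun η => (ContinuousLinearMap.apply ℝ (Momenta n) u).comp
        ((fderiv ℝ Γ (x, η)).comp (ContinuousLinearMap.inr ℝ (Coord n) (Momenta n))))
      (fderiv_inverse_metric_symm hΩ hb hsymm hinv hx u) hN ?_ ?_ hz ?_
    · intro η hη
      have h1 : HasFDerivAt (fun η => Γ (x, η)) _ η :=
        HasFDerivAt.comp (g := Γ) η (hdΓ _ hη) (hincl η)
      exact HasFDerivAt.comp (g := ContinuousLinearMap.apply ℝ (Momenta n) u) η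
        (ContinuousLinearMap.hasFDerivAt _) h1
    · intro η hη
      have h1 := hH _ hη u
      obtain ⟨h2, h3⟩ := hasFDerivAt_metricHamiltonian hΩ hb hsymm hinv (z := (x, η)) hx
      rw [h2, h3] at h1
      exact h1
    · intro s
      have h1 : ContDiffAt ℝ ∞ (fun y => fderiv ℝ Γ y (0, s) u) (x, p) :=
        (((hΓ.contDiffAt (hW.mem_nhds hz)).fderiv_right (m := ∞) (by simp)).clm_apply
          contDiffAt_const).clm_apply contDiffAt_const
      have h2 : HasFDerivAt (fun η => fderiv ℝ Γ (x, η) (0, s) u)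
          ((fderiv ℝ (fun y => fderiv ℝ Γ y (0, s) u) (x, p)).comp
            (ContinuousLinearMap.inr ℝ (Coord n) (Momenta n))) p :=
        HasFDerivAt.comp (g := fun y => fderiv ℝ Γ y (0, s) u) p
          (h1.differentiableAt (by simp)).hasFDerivAt (hincl p)
      have h3 : (fderiv ℝ (fun y => fderiv ℝ Γ y (0, s) u) (x, p)).comp
          (ContinuousLinearMap.inr ℝ (Coord n) (Momenta n)) = 0 :=
        ContinuousLinearMap.ext fun q =>
          fderiv_fderiv_eq_zero_of_isFlatLinearizationOn hW hΓ hflat hz u s q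
      rw [h3] at h2
      exact h2
  -- Torsion-freeness: the symmetry of `Γ` passes to its fibre derivative.
  have hCsymm : ∀ s u v, C s u v = C s v u := by
    intro s u v
    have h1 : ∀ u v, HasFDerivAt (fun y => Γ y u v) _ (x, p) := fun u v =>
      ((hdΓ _ hz).clm_apply (hasFDerivAt_const u _)).clm_apply (hasFDerivAt_const v _)
    have h2 := (h1 u v).unique ((h1 v u).congr_of_eventuallyEq
      (Filter.eventuallyEq_of_mem (hW.mem_nhds hz) fun y hy => hΓsymm y hy u v))
    have := DFunLike.congr_fun h2 (0, s)
    simpa [hC] using this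
  -- Metric compatibility, obtained by lowering the indices with `s = b v` and `q = b w`.
  have hmetric : ∀ u v w, -fderiv ℝ b x u v w = C (b x v) u w + C (b x w) u v := by
    intro u v w
    have h1 := (key u).1 (b x v) (b x w)
    rw [fderiv_inverse_metric_apply hΩ hb hinv hx, map_neg,
      inverse_symm (hinv x hx) (hsymm x hx), (hinv x hx).inverse_apply_self,
      (hinv x hx).inverse_apply_self] at h1
    exact h1
  refine ⟨C, ?_, fun u v w => ?_⟩
  · ext u v
    have := (key u).2 (b x v)
    rwa [(hinv x hx).inverse_apply_self] at this
  · have h1 := hmetric u v w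
    have h2 := hmetric v u w
    have h3 := hmetric w u v
    have h4 := hCsymm (b x v) u w
    have h5 := hCsymm (b x w) u v
    have h6 := hCsymm (b x u) v w
    simp only
    linarith

end MetricCoordinates

end CotangentConnection

namespace CotangentConnection

/-! ### Smoothness of the canonical coordinates of the cotangent bundle -/

section CanonicalSmoothness

variable {n : ℕ} {M : Type*} [TopologicalSpace M] [ChartedSpace (Coord n) M]
  [IsManifold (𝓡 n) ∞ M] {e : OpenPartialHomeomorph M (Coord n)}

omit [IsManifold (𝓡 n) ∞ M] in
theorem mdifferentiable_of_mem_maximalAtlas (he : e ∈ IsManifold.maximalAtlas (𝓡 n) ∞ M) :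
    e.MDifferentiable (𝓡 n) (𝓡 n) :=
  ⟨(contMDiffOn_of_mem_maximalAtlas he).mdifferentiableOn (by simp),
    (contMDiffOn_symm_of_mem_maximalAtlas he).mdifferentiableOn (by simp)⟩

omit [IsManifold (𝓡 n) ∞ M] in
theorem mfderiv_symm_apply_mfderiv (he : e ∈ IsManifold.maximalAtlas (𝓡 n) ∞ M) {x : Coord n}
    (hx : x ∈ e.target) (v : TangentSpace (𝓡 n) (e.symm x)) :
    mfderiv (𝓡 n) (𝓡 n) e.symm x (mfderiv (𝓡 n) (𝓡 n) e (e.symm x) v) = v := by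
  have h := (mdifferentiable_of_mem_maximalAtlas he).symm_comp_deriv (e.map_target hx)
  rw [e.right_inv hx] at h
  exact DFunLike.congr_fun h v

omit [IsManifold (𝓡 n) ∞ M] in
theorem mfderiv_apply_mfderiv_symm (he : e ∈ IsManifold.maximalAtlas (𝓡 n) ∞ M) {x : Coord n}
    (hx : x ∈ e.target) (v : TangentSpace (𝓡 n) x) :
    mfderiv (𝓡 n) (𝓡 n) e (e.symm x) (mfderiv (𝓡 n) (𝓡 n) e.symm x v) = v :=
  DFunLike.congr_fun ((mdifferentiable_of_mem_maximalAtlas he).comp_symm_deriv hx) v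

/-- In the bundle trivialization the fibre component is `p` composed with the derivative of `e`,
both smooth in `(x, p)`. This carries open sets and smooth functions on $T^*M$ over to canonical
coordinates. -/
theorem contMDiffAt_ofCanonical (he : e ∈ IsManifold.maximalAtlas (𝓡 n) ∞ M)
    {z : Coord n × Momenta n} (hz : z.1 ∈ e.target) :
    ContMDiffAt 𝓘(ℝ, Coord n × Momenta n) ((𝓡 n).prod 𝓘(ℝ, Momenta n)) ∞
      (ofCanonical (M := M) e) z := by
  have hfst : ContMDiffAt 𝓘(ℝ, Coord n × Momenta n) (𝓡 n) ∞
      (fun y : Coord n × Momenta n => e.symm y.1) z :=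
    (contMDiffAt_symm_of_mem_maximalAtlas he hz).comp z contDiffAt_fst.contMDiffAt
  rw [contMDiffAt_hom_bundle]
  refine ⟨hfst, ?_⟩
  have h1 := ((contMDiffAt_of_mem_maximalAtlas he (e.map_target hz)).mfderiv_const
    (m := ∞) (by simp)).comp z hfst
  have h2 : ContMDiffAt 𝓘(ℝ, Coord n × Momenta n) 𝓘(ℝ, Momenta n) ∞
      (fun y : Coord n × Momenta n => y.2) z := contDiffAt_snd.contMDiffAt
  have h3 := h2.clm_comp h1
  refine h3.congr_of_eventuallyEq (Filter.Eventually.of_forall fun y => ?_)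
  simp [ContinuousLinearMap.inCoordinates, inTangentCoordinates, ofCanonical]
  ext v
  rfl

end CanonicalSmoothness

end CotangentConnection

/-! ### The metric and its Hamiltonian in a chart -/

namespace PseudoRiemannianMetric

open CotangentConnection

variable {n : ℕ} {M : Type*} [TopologicalSpace M] [ChartedSpace (Coord n) M]
  [IsManifold (𝓡 n) ∞ M] (g : PseudoRiemannianMetric n M)
  {e : OpenPartialHomeomorph M (Coord n)}

/-- The metric in the coordinates `e`. -/
def inChart (e : OpenPartialHomeomorph M (Coord n)) (x : Coord n) : Coord n →L[ℝ] Momenta n :=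
  let B : Coord n →L[ℝ] Momenta n := g.val (e.symm x)
  let L : Coord n →L[ℝ] Coord n := mfderiv (𝓡 n) (𝓡 n) e.symm x
  B.bilinearComp L L

theorem gram_apply (x : Coord n) (i j : Fin n) :
    g.gram e x i j = g.inChart e x (basisVec i) (basisVec j) := rfl

theorem inChart_symm (x v w : Coord n) : g.inChart e x v w = g.inChart e x w v :=
  g.symm _ _ _

theorem contDiffOn_inChart (he : e ∈ IsManifold.maximalAtlas (𝓡 n) ∞ M) :
    ContDiffOn ℝ ∞ (g.inChart e) e.target := by
  rw [contDiffOn_clm_apply]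
  intro v
  rw [contDiffOn_clm_apply]
  intro w x hx
  have hs := contMDiffAt_symm_of_mem_maximalAtlas he hx
  have hvec : ∀ v : Coord n, ContMDiffAt (𝓡 n) ((𝓡 n).prod 𝓘(ℝ, Coord n)) ∞
      (fun y => Bundle.TotalSpace.mk' (Coord n) (E := fun q : M => TangentSpace (𝓡 n) q) (e.symm y)
        (mfderiv (𝓡 n) (𝓡 n) e.symm y v)) x := fun v =>
    ContMDiffAt.clm_apply_of_inCoordinates (hs.mfderiv_const (m := ∞) (by simp))
      (contMDiffAt_vectorSpace_iff_contDiffAt.2 contDiffAt_const) hs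
  have h1 : ContMDiffAt (𝓡 n) ((𝓡 n).prod 𝓘(ℝ)) ∞ (fun y => Bundle.TotalSpace.mk' ℝ
      (E := Bundle.Trivial M ℝ) (e.symm y) (g.inChart e y v w)) x := by
    apply ContMDiffAt.clm_bundle_apply₂ (F₁ := Coord n) (F₂ := Coord n)
    · exact g.contMDiff.contMDiffAt.comp x hs
    · exact hvec v
    · exact hvec w
  rw [Bundle.contMDiffAt_totalSpace] at h1
  exact h1.2.contDiffAt.contDiffWithinAt

theorem isInvertible_inChart (he : e ∈ IsManifold.maximalAtlas (𝓡 n) ∞ M) {x : Coord n}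
    (hx : x ∈ e.target) : (g.inChart e x).IsInvertible := by
  have hinj : Function.Injective (g.inChart e x) := by
    rw [injective_iff_map_eq_zero]
    intro v hv
    have h1 : mfderiv (𝓡 n) (𝓡 n) e.symm x v = 0 := g.nondegenerate _ _ fun w => by
      have := DFunLike.congr_fun hv (mfderiv (𝓡 n) (𝓡 n) e (e.symm x) w)
      rw [← mfderiv_symm_apply_mfderiv he hx w]
      exact this
    rw [← mfderiv_apply_mfderiv_symm he hx v, h1, map_zero]
    rfl
  exact ⟨(LinearEquiv.ofInjectiveOfFinrankEq (g.inChart e x).toLinearMap hinj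
    (finrank_dual (Coord n)).symm).toContinuousLinearEquiv, by ext; rfl⟩

theorem val_sharp (x : M) (p : TangentSpace (𝓡 n) x →L[ℝ] ℝ) : g.val x (g.sharp x p) = p :=
  Function.surjInv_eq _ p

theorem inCanonical_geodesicHamiltonian (he : e ∈ IsManifold.maximalAtlas (𝓡 n) ∞ M)
    {z : Coord n × Momenta n} (hz : z.1 ∈ e.target) :
    inCanonical e g.geodesicHamiltonian z = metricHamiltonian (g.inChart e) z := by
  obtain ⟨x, p⟩ := z
  have hx : x ∈ e.target := hz
  -- With the momentum written as the lowering of a vector `v`, both sides become $\tfrac12g(v,v)$.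
  obtain ⟨v, rfl⟩ := (g.isInvertible_inChart he hx).bijective.2 p
  have h1 : g.sharp (e.symm x) ((g.inChart e x v).comp (mfderiv (𝓡 n) (𝓡 n) e (e.symm x)))
      = mfderiv (𝓡 n) (𝓡 n) e.symm x v := by
    apply (g.val_bijective _).1
    rw [val_sharp]
    ext w
    conv_rhs => rw [← mfderiv_symm_apply_mfderiv he hx w]
    rfl
  rw [metricHamiltonian, (g.isInvertible_inChart he hx).inverse_apply_self]
  change 1 / 2 * (g.inChart e x v) (mfderiv (𝓡 n) (𝓡 n) e (e.symm x)
    (g.sharp (e.symm x) ((g.inChart e x v).comp (mfderiv (𝓡 n) (𝓡 n) e (e.symm x))))) = _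
  rw [h1]
  exact congrArg (fun w : Coord n => 1 / 2 * g.inChart e x v w)
    (mfderiv_apply_mfderiv_symm he hx v)

end PseudoRiemannianMetric

namespace CotangentConnection

/-! ### The annihilating connection in canonical coordinates of the manifold -/

section CanonicalDomain

variable {n : ℕ} {M : Type*} [TopologicalSpace M] [ChartedSpace (Coord n) M]
  [IsManifold (𝓡 n) ∞ M] {e : OpenPartialHomeomorph M (Coord n)}
  {U : Set (CotangentBundle n M)}

theorem isOpen_canonicalDomain (he : e ∈ IsManifold.maximalAtlas (𝓡 n) ∞ M) (hU : IsOpen U) :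
    IsOpen (canonicalDomain e U) := by
  have h1 : ContinuousOn (ofCanonical (M := M) e) {z | z.1 ∈ e.target} := fun z hz =>
    (contMDiffAt_ofCanonical he hz).continuousAt.continuousWithinAt
  exact h1.isOpen_inter_preimage (e.open_target.preimage continuous_fst) hU

theorem contDiffOn_inCanonical (he : e ∈ IsManifold.maximalAtlas (𝓡 n) ∞ M) (hU : IsOpen U)
    {f : CotangentBundle n M → ℝ}
    (hf : ContMDiffOn ((𝓡 n).prod 𝓘(ℝ, Momenta n)) 𝓘(ℝ, ℝ) ∞ f U) :
    ContDiffOn ℝ ∞ (inCanonical e f) (canonicalDomain e U) := fun z hz =>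
  ((hf.contMDiffAt (hU.mem_nhds hz.2)).comp z
    (contMDiffAt_ofCanonical he hz.1)).contDiffAt.contDiffWithinAt

variable {H : CotangentBundle n M → ℝ} {f : Fin n → CotangentBundle n M → ℝ}

theorem IsCompletelyIntegrableOn.contDiffOn_connCoeff (hint : IsCompletelyIntegrableOn H f U)
    (he : e ∈ IsManifold.maximalAtlas (𝓡 n) ∞ M) :
    ContDiffOn ℝ ∞ (connCoeff f e) (canonicalDomain e U) := fun z hz =>
  (contDiffAt_annihilatorCoeff (hint.transversal e he z hz) fun a =>
    (contDiffOn_inCanonical he hint.isOpen (hint.smooth a)).contDiffAt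
      ((isOpen_canonicalDomain he hint.isOpen).mem_nhds hz)).contDiffWithinAt

theorem IsCompletelyIntegrableOn.connCoeff_symm (hint : IsCompletelyIntegrableOn H f U)
    (he : e ∈ IsManifold.maximalAtlas (𝓡 n) ∞ M) {z : Coord n × Momenta n}
    (hz : z ∈ canonicalDomain e U) (u v : Coord n) :
    connCoeff f e z u v = connCoeff f e z v u :=
  annihilatorCoeff_symm (hint.transversal e he z hz)
    (fun a b => hint.involution a b e he z hz) u v

end CanonicalDomain

end CotangentConnection

/-! ### Identification with the dual of the Levi-Civita connection -/

namespace PseudoRiemannianMetric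

open CotangentConnection

variable {n : ℕ} {M : Type*} [TopologicalSpace M] [ChartedSpace (Coord n) M]
  [IsManifold (𝓡 n) ∞ M] (g : PseudoRiemannianMetric n M)
  {e : OpenPartialHomeomorph M (Coord n)}

theorem hasFDerivAt_inChart (he : e ∈ IsManifold.maximalAtlas (𝓡 n) ∞ M) {x : Coord n}
    (hx : x ∈ e.target) : HasFDerivAt (g.inChart e) (fderiv ℝ (g.inChart e) x) x :=
  (((g.contDiffOn_inChart he).contDiffAt (e.open_target.mem_nhds hx)).differentiableAt
    (by simp)).hasFDerivAt

theorem gramDeriv_eq (he : e ∈ IsManifold.maximalAtlas (𝓡 n) ∞ M) {x : Coord n}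
    (hx : x ∈ e.target) (i j l : Fin n) :
    g.gramDeriv e x i j l
      = fderiv ℝ (g.inChart e) x (basisVec i) (basisVec j) (basisVec l) := by
  have h1 : HasFDerivAt (fun y => g.gram e y j l) _ x :=
    ((g.hasFDerivAt_inChart he hx).clm_apply (hasFDerivAt_const (basisVec j) x)).clm_apply
      (hasFDerivAt_const (basisVec l) x)
  simp [gramDeriv, h1.fderiv]

theorem isUnit_det_gram (he : e ∈ IsManifold.maximalAtlas (𝓡 n) ∞ M) {x : Coord n}
    (hx : x ∈ e.target) : IsUnit (g.gram e x).det := by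
  rw [← Matrix.isUnit_iff_isUnit_det, ← Matrix.mulVec_injective_iff_isUnit]
  rw [← Matrix.coe_mulVecLin, injective_iff_map_eq_zero]
  intro v hv
  have h1 : g.inChart e x (WithLp.toLp 2 v) = 0 := by
    ext w
    have h2 : ∀ i, g.inChart e x (WithLp.toLp 2 v) (basisVec i) = 0 := by
      intro i
      have h3 := congrFun hv i
      rw [g.inChart_symm, momenta_apply_eq_sum]
      simpa [Matrix.mulVec, dotProduct, gram_apply, mul_comm] using h3
    rw [momenta_apply_eq_sum]
    simp [h2]
  have h4 := (g.isInvertible_inChart he hx).bijective.1 (h1.trans (map_zero _).symm)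
  exact congrArg WithLp.ofLp h4

/-- Raising the index with $g^{kl}$ turns the forms $g(\partial_l,\cdot)$ into $dx^k$. This is the
passage from Christoffel symbols of the first kind to the second kind. -/
theorem sum_inv_gram_smul (he : e ∈ IsManifold.maximalAtlas (𝓡 n) ∞ M) {x : Coord n}
    (hx : x ∈ e.target) (k : Fin n) :
    ∑ l, (g.gram e x)⁻¹ k l • g.inChart e x (basisVec l) = basisCovec k := by
  have h1 : (g.gram e x)⁻¹ * g.gram e x = 1 :=
    Matrix.nonsing_inv_mul _ (g.isUnit_det_gram he hx)
  rw [momenta_eq_sum (∑ l, (g.gram e x)⁻¹ k l • g.inChart e x (basisVec l))]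
  have h2 : ∀ m, (∑ l, (g.gram e x)⁻¹ k l • g.inChart e x (basisVec l)) (basisVec m)
      = (1 : Matrix (Fin n) (Fin n) ℝ) k m := by
    intro m
    rw [← h1, Matrix.mul_apply]
    simp [gram_apply]
  simp [h2, Matrix.one_apply]

theorem eqDualLeviCivita (U : Set (CotangentBundle n M)) (f : Fin n → CotangentBundle n M → ℝ)
    (hint : IsCompletelyIntegrableOn g.geodesicHamiltonian f U)
    (hflat : HasFlatLinearization f U) : g.EqDualLeviCivita f U := by
  intro e he z hz i j
  have hW := isOpen_canonicalDomain he hint.isOpen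
  have hH : ∀ z ∈ canonicalDomain e U, ∀ u, positionDeriv (metricHamiltonian (g.inChart e)) z u
      = verticalDeriv (metricHamiltonian (g.inChart e)) z (connCoeff f e z u) := by
    intro z hz u
    have h1 := positionDeriv_eq_of_involution (hint.transversal e he z hz)
      (fun a b => hint.involution a b e he z hz) (fun a => hint.constant_of_motion a e he z hz) u
    have h2 : inCanonical e g.geodesicHamiltonian =ᶠ[nhds z] metricHamiltonian (g.inChart e) :=
      Filter.eventuallyEq_of_mem (hW.mem_nhds hz) fun y hy =>
        g.inCanonical_geodesicHamiltonian he hy.1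
    simpa only [positionDeriv, verticalDeriv, h2.fderiv_eq, connCoeff] using h1
  obtain ⟨C, hC, hchr⟩ := coeff_of_isFlatLinearizationOn e.open_target (g.contDiffOn_inChart he)
    (fun x _ => g.inChart_symm x) (fun x hx => g.isInvertible_inChart he hx) hW (fun z hz => hz.1)
    (hint.contDiffOn_connCoeff he) (fun z hz => hint.connCoeff_symm he hz) hH (hflat e he) hz
  -- The $l$-th first-kind bracket is $-2\,C(g(\partial_l,\cdot))_{ij}$; contraction with
  -- $\tfrac12g^{kl}$ and linearity of `C` give the value at $dx^k$.
  have h1 : ∀ k, g.christoffel e z.1 k i j = -C (basisCovec k) (basisVec i) (basisVec j) := by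
    intro k
    rw [← g.sum_inv_gram_smul he hz.1 k, christoffel]
    simp only [g.gramDeriv_eq he hz.1, hchr, map_sum, map_smul, sum_apply, smul_apply, smul_eq_mul,
      Finset.mul_sum, ← Finset.sum_neg_distrib]
    exact Finset.sum_congr rfl fun l _ => by ring
  rw [dualLeviCivitaCoeff, hC]
  conv_lhs => rw [momenta_eq_sum z.2]
  simp [h1, mul_comm]

theorem isLinearConnection_of_eqDualLeviCivita {U : Set (CotangentBundle n M)}
    {f : Fin n → CotangentBundle n M → ℝ} (h : g.EqDualLeviCivita f U) :
    IsLinearConnection f U := by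
  intro e he x p c hp hcp
  ext u v
  have h1 : ∀ i j, connCoeff f e (x, c • p) (basisVec i) (basisVec j)
      = c * connCoeff f e (x, p) (basisVec i) (basisVec j) := by
    intro i j
    rw [h e he _ hp, h e he _ hcp]
    simp only [dualLeviCivitaCoeff, smul_apply, smul_eq_mul, mul_neg, Finset.mul_sum]
    exact congrArg Neg.neg (Finset.sum_congr rfl fun k _ => by ring)
  have h2 : ∀ L : Coord n →L[ℝ] Momenta n, L u v
      = ∑ i, ∑ j, u i * v j * L (basisVec i) (basisVec j) := by
    intro L
    conv_lhs => rw [coord_eq_sum u, coord_eq_sum v]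
    simp only [map_sum, map_smul, sum_apply, smul_apply, smul_eq_mul, Finset.mul_sum]
    rw [Finset.sum_comm]
    exact Finset.sum_congr rfl fun i _ => Finset.sum_congr rfl fun j _ => by ring
  rw [h2, h2 (c • _)]
  simp [h1]

end PseudoRiemannianMetric

namespace CotangentConnection

/-! ### Affine charts: constancy of the metric, ignorable coordinates and separation -/

section Separation

variable {n : ℕ}

/-- The covector `∑ᵢ cᵢ dxⁱ`. -/
def constCovec (n : ℕ) : Coord n →L[ℝ] Momenta n :=
  ∑ i, (basisCovec i).smulRight (basisCovec i)

theorem constCovec_apply (c x : Coord n) : constCovec n c x = ∑ i, x i * c i := by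
  simp [constCovec, basisCovec, sum_apply, mul_comm]

theorem constCovec_bijective : Function.Bijective (constCovec n) := by
  constructor
  · rw [injective_iff_map_eq_zero]
    intro c hc
    ext i
    have := DFunLike.congr_fun hc (basisVec i)
    rw [constCovec_apply] at this
    simpa [basisVec, Pi.single_apply] using this
  · intro p
    refine ⟨WithLp.toLp 2 fun i => p (basisVec i), ?_⟩
    ext x
    rw [constCovec_apply, momenta_apply_eq_sum]

end Separation

end CotangentConnection

namespace PseudoRiemannianMetric

open CotangentConnection

variable {n : ℕ} {M : Type*} [TopologicalSpace M] [ChartedSpace (Coord n) M]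
  [IsManifold (𝓡 n) ∞ M] (g : PseudoRiemannianMetric n M)
  {e : OpenPartialHomeomorph M (Coord n)}

theorem gramDeriv_eq_zero (he : g.IsAffineChart e) {x : Coord n} (hx : x ∈ e.target)
    (i j l : Fin n) : g.gramDeriv e x i j l = 0 := by
  have hT : ∀ i j l,
      g.gramDeriv e x i j l + g.gramDeriv e x j i l - g.gramDeriv e x l i j = 0 := by
    intro i j l
    set T : Fin n → ℝ := fun l =>
      g.gramDeriv e x i j l + g.gramDeriv e x j i l - g.gramDeriv e x l i j with hT
    have h1 : (g.gram e x)⁻¹.mulVec T = 0 := by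
      ext k
      have := he.2 x hx k i j
      rw [christoffel] at this
      simpa [Matrix.mulVec, dotProduct] using this
    -- Multiplication by the Gram matrix recovers the first-kind symbols, which therefore vanish.
    have h2 : T = 0 := by
      have h3 := congrArg (g.gram e x).mulVec h1
      rwa [Matrix.mulVec_mulVec, Matrix.mul_nonsing_inv _ (g.isUnit_det_gram he.1 hx),
        Matrix.one_mulVec, Matrix.mulVec_zero] at h3
    exact congrFun h2 l
  have hs : ∀ i j l, g.gramDeriv e x i j l = g.gramDeriv e x i l j := fun i j l => by
    have : (fun y => g.gram e y j l) = fun y => g.gram e y l j := funext fun y => g.symm _ _ _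
    rw [gramDeriv, this, gramDeriv]
  -- Two first-kind symbols add up to $2\,\partial_ig_{jl}$.
  linarith [hT i j l, hT i l j, hs i j l]

theorem fderiv_inChart_eq_zero (he : g.IsAffineChart e) {x : Coord n} (hx : x ∈ e.target) :
    fderiv ℝ (g.inChart e) x = 0 := by
  ext u v w
  have h : ∀ i j l, fderiv ℝ (g.inChart e) x (basisVec i) (basisVec j) (basisVec l) = 0 :=
    fun i j l => by rw [← g.gramDeriv_eq he.1 hx, g.gramDeriv_eq_zero he hx]
  rw [coord_eq_sum u, coord_eq_sum v, coord_eq_sum w]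
  simp only [map_sum, map_smul, sum_apply, smul_apply, h, smul_zero, Finset.sum_const_zero,
    zero_apply]

theorem inChart_eq_of_isPreconnected (he : g.IsAffineChart e) {s : Set (Coord n)} (hs : IsOpen s)
    (hs' : IsPreconnected s) (hse : s ⊆ e.target) {x y : Coord n} (hx : x ∈ s) (hy : y ∈ s) :
    g.inChart e x = g.inChart e y :=
  hs.is_const_of_fderiv_eq_zero (𝕜 := ℝ) hs'
    (fun z hz => (g.hasFDerivAt_inChart he.1 (hse hz)).differentiableAt.differentiableWithinAt)
    (fun z hz => by rw [g.fderiv_inChart_eq_zero he (hse hz)]; rfl) hx hy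

theorem isIgnorable (he : g.IsAffineChart e) (i : Fin n) :
    IsIgnorable g.geodesicHamiltonian e i := by
  intro x hx p
  -- Ignorability is local, so constancy of the metric on a ball is enough and the chart need not be
  -- connected.
  obtain ⟨r, hr, hball⟩ := Metric.isOpen_iff.1 e.open_target x hx
  have hcont : Continuous fun t : ℝ => x + t • (basisVec i : Coord n) := by fun_prop
  have hmem : ∀ᶠ t : ℝ in nhds 0, x + t • basisVec i ∈ Metric.ball x r :=
    hcont.continuousAt.eventually_mem (Metric.isOpen_ball.mem_nhds (by simpa using hr))
  have hconst : ∀ y ∈ Metric.ball x r, inCanonical e g.geodesicHamiltonian (y, p)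
      = inCanonical e g.geodesicHamiltonian (x, p) := by
    intro y hy
    rw [g.inCanonical_geodesicHamiltonian he.1 (z := (y, p)) (hball hy),
      g.inCanonical_geodesicHamiltonian he.1 (z := (x, p)) hx, metricHamiltonian,
      metricHamiltonian, g.inChart_eq_of_isPreconnected he Metric.isOpen_ball
        (convex_ball x r).isPreconnected hball hy (Metric.mem_ball_self hr)]
  exact (hasDerivAt_const (0 : ℝ)
    (inCanonical e g.geodesicHamiltonian (x, p))).congr_of_eventuallyEq
    (hmem.mono fun t ht => hconst _ ht)

theorem hamiltonJacobiSeparable (he : g.IsAffineChart e) (hconn : IsPreconnected e.source) :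
    HamiltonJacobiSeparable g.geodesicHamiltonian e := by
  -- The momentum of $S=\sum_i c_ix^i$ is independent of $x$ and a linear bijection in $c$, so all
  -- of $\mathbb R^n$ serves as parameter set.
  let S : Fin n → ℝ × Coord n → ℝ := fun i q => q.1 * q.2 i
  have hS : ∀ c, separatedSum S c = constCovec n c := fun c => by
    ext x; rw [constCovec_apply]; rfl
  have hdS : ∀ c x, fderiv ℝ (separatedSum S c) x = constCovec n c := fun c x => by
    rw [hS]; exact ContinuousLinearMap.fderiv _
  have htarget : IsPreconnected e.target := by
    rw [← e.image_source_eq_target]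
    exact hconn.image _ e.continuousOn
  refine ⟨Set.univ, S, isOpen_univ, fun i => ?_, fun c _ => ?_, fun x _ => ⟨?_, fun c _ => ?_⟩⟩
  · have : ContDiff ℝ ∞ fun q : ℝ × Coord n => q.1 * basisCovec i q.2 :=
      contDiff_fst.mul ((basisCovec i).contDiff.comp contDiff_snd)
    exact this.contDiffOn
  · by_cases hne : e.target.Nonempty
    · obtain ⟨x₀, hx₀⟩ := hne
      refine ⟨metricHamiltonian (g.inChart e) (x₀, constCovec n c), fun x hx => ?_⟩
      rw [hdS, g.inCanonical_geodesicHamiltonian he.1 (z := (x, constCovec n c)) hx,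
        metricHamiltonian, metricHamiltonian,
        g.inChart_eq_of_isPreconnected he e.open_target htarget subset_rfl hx hx₀]
    · exact ⟨0, fun x hx => (hne ⟨x, hx⟩).elim⟩
  · simp only [hdS]
    exact (Set.bijOn_univ).2 constCovec_bijective
  · simp only [hdS]
    rw [ContinuousLinearMap.fderiv]
    exact constCovec_bijective

end PseudoRiemannianMetric

namespace CotangentConnection

/-! ### Parallel 1-forms and the coordinates that they integrate to -/

section ParallelSections

variable {n : ℕ} {F : Fin n → Coord n × Momenta n → ℝ} {W : Set (Coord n × Momenta n)}

/-- Bootstrap: if `θ` is $C^k$, its derivative $A(x,\theta(x))$ is $C^k$, so `θ` is $C^{k+1}$. -/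
theorem contDiffOn_of_hasFDerivAt_comp {E G : Type*} [NormedAddCommGroup E] [NormedSpace ℝ E]
    [NormedAddCommGroup G] [NormedSpace ℝ G] {B : Set E} (hB : IsOpen B) {θ : E → G}
    {W : Set (E × G)} {A : E × G → E →L[ℝ] G} (hA : ContDiffOn ℝ ∞ A W)
    (hmem : ∀ x ∈ B, (x, θ x) ∈ W) (hθ : ∀ x ∈ B, HasFDerivAt θ (A (x, θ x)) x) :
    ContDiffOn ℝ ∞ θ B := by
  rw [contDiffOn_infty]
  intro k
  induction k with
  | zero => exact contDiffOn_zero.2 fun x hx => (hθ x hx).continuousAt.continuousWithinAt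
  | succ k ih =>
    have h1 : ContDiffOn ℝ k (fun x => A (x, θ x)) B :=
      (hA.of_le (by exact_mod_cast le_top)).comp (contDiffOn_id.prodMk ih) hmem
    push_cast
    rw [contDiffOn_succ_iff_fderiv_of_isOpen hB]
    exact ⟨fun x hx => (hθ x hx).differentiableAt.differentiableWithinAt, by simp,
      h1.congr fun x hx => (hθ x hx).fderiv⟩

/-- Through every point of `W` passes a section along which the functions `F_a` are constant. -/
theorem exists_parallel_section (hW : IsOpen W) (hF : ∀ a, ContDiffOn ℝ ∞ (F a) W)
    (hind : ∀ z ∈ W, LinearIndependent ℝ fun a => verticalDeriv (F a) z)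
    {z : Coord n × Momenta n} (hz : z ∈ W) :
    ∃ θ : Coord n → Momenta n, θ z.1 = z.2 ∧ ∀ᶠ x in nhds z.1, (x, θ x) ∈ W ∧
      (∀ a, F a (x, θ x) = F a z) ∧ HasFDerivAt θ (-annihilatorCoeff F (x, θ x)) x := by
  let Φ : Coord n × Momenta n → Fin n → ℝ := fun y a => F a y
  have hΦ : ContDiffAt ℝ 1 Φ z := contDiffAt_pi.2 fun a =>
    ((hF a).contDiffAt (hW.mem_nhds hz)).of_le (by simp)
  have hdF : ∀ y ∈ W, ∀ a, HasFDerivAt (F a) (fderiv ℝ (F a) y) y := fun y hy a =>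
    (((hF a).contDiffAt (hW.mem_nhds hy)).differentiableAt (by simp)).hasFDerivAt
  have hdΦ : fderiv ℝ Φ z = ContinuousLinearMap.pi fun a => fderiv ℝ (F a) z :=
    (hasFDerivAt_pi.2 fun a => hdF z hz a).fderiv
  have hinv : (fderiv ℝ Φ z ∘L .inr ℝ (Coord n) (Momenta n)).IsInvertible := by
    rw [hdΦ]
    exact isInvertible_pi_verticalDeriv (hind z hz)
  -- The section is the implicit function of the joint level set, a graph because the fibre
  -- derivatives are independent. Here it is only $C^1$; smoothness follows later from its
  -- differential equation.
  refine ⟨hΦ.implicitFunction one_ne_zero hinv, hΦ.implicitFunction_apply_self one_ne_zero hinv, ?_⟩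
  set θ := hΦ.implicitFunction one_ne_zero hinv with hθ
  have hC : ContDiffAt ℝ 1 θ z.1 := hΦ.contDiffAt_implicitFunction one_ne_zero hinv
  have hz0 : (z.1, θ z.1) = z := by
    rw [hθ, hΦ.implicitFunction_apply_self one_ne_zero hinv]
  have hmem : ∀ᶠ x in nhds z.1, (x, θ x) ∈ W := by
    have hc : ContinuousAt (fun x => (x, θ x)) z.1 := continuousAt_id.prodMk hC.continuousAt
    exact hc.eventually_mem (by rw [hz0]; exact hW.mem_nhds hz)
  have hval : ∀ᶠ x in nhds z.1, Φ (x, θ x) = Φ z :=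
    hΦ.eventually_apply_implicitFunction one_ne_zero hinv
  filter_upwards [hmem, hval, hval.eventually_nhds, hC.eventually (by simp)] with x h1 h2 h3 h4
  refine ⟨h1, fun a => congrFun h2 a, ?_⟩
  have hd := (h4.differentiableAt one_ne_zero).hasFDerivAt
  have h5 : fderiv ℝ θ x = -annihilatorCoeff F (x, θ x) := by
    refine ContinuousLinearMap.ext fun u => ?_
    refine (mem_annihilator_iff F (x, θ x) (hind _ h1) u _).1 fun a => ?_
    have h6 : HasFDerivAt (fun x => F a (x, θ x)) _ x :=
      HasFDerivAt.comp (g := F a) x (hdF _ h1 a) ((hasFDerivAt_id x).prodMk hd)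
    have h7 := h6.unique ((hasFDerivAt_const (F a z) x).congr_of_eventuallyEq
      (h3.mono fun y hy => congrFun hy a))
    exact DFunLike.congr_fun h7 u
  rw [← h5]
  exact hd

theorem exists_linearIndependent_fibre (hW : IsOpen W) {z : Coord n × Momenta n} (hz : z ∈ W) :
    ∃ p : Fin n → Momenta n, LinearIndependent ℝ p ∧ ∀ k, (z.1, p k) ∈ W := by
  set s := ∑ i, z.2 (basisVec i) with hs
  have h1 : ∀ k, ∀ᶠ ε : ℝ in nhds 0, (z.1, z.2 + ε • basisCovec k) ∈ W := by
    intro k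
    have hc : Continuous fun ε : ℝ => (z.1, z.2 + ε • (basisCovec k : Momenta n)) := by fun_prop
    exact hc.continuousAt.eventually_mem (by simpa using hW.mem_nhds hz)
  have h2 : ∀ᶠ ε : ℝ in nhdsWithin 0 {0}ᶜ, s + ε ≠ 0 := by
    by_cases h : s = 0
    · filter_upwards [self_mem_nhdsWithin] with ε hε
      simpa [h] using hε
    · have hc : Continuous fun ε : ℝ => s + ε := by fun_prop
      exact (hc.continuousAt.eventually_ne (by simpa using h)).filter_mono nhdsWithin_le_nhds
  -- The covectors `z.2 + ε • basisCovec k` have determinant $\varepsilon^{n-1}(\varepsilon+s)$,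
  -- with `s` the sum of the components of `z.2`. Small `ε` other than `0` and `-s` therefore gives
  -- a basis inside the open set `W`.
  obtain ⟨ε, hε1, hε2, hε3⟩ := (((Filter.eventually_all.2 h1).filter_mono
    nhdsWithin_le_nhds).and (h2.and self_mem_nhdsWithin)).exists
  refine ⟨fun k => z.2 + ε • basisCovec k, ?_, hε1⟩
  rw [Fintype.linearIndependent_iff]
  intro c hc
  have h3 : ∀ i, (∑ k, c k) * z.2 (basisVec i) + ε * c i = 0 := by
    intro i
    have := DFunLike.congr_fun hc (basisVec i)
    simpa [basisCovec, basisVec, Pi.single_apply, mul_add, Finset.sum_add_distrib,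
      Finset.sum_mul, mul_comm] using this
  have h4 : (∑ k, c k) * (s + ε) = 0 := by
    have := Finset.sum_congr rfl fun i (_ : i ∈ Finset.univ) => h3 i
    rw [Finset.sum_add_distrib, ← Finset.mul_sum, ← Finset.mul_sum, Finset.sum_const_zero] at this
    linarith
  have h5 : ∑ k, c k = 0 := (mul_eq_zero.1 h4).resolve_right hε2
  intro i
  have := h3 i
  rw [h5, zero_mul, zero_add] at this
  exact (mul_eq_zero.1 this).resolve_left hε3

/-- A local diffeomorphism `φ` of `ℝⁿ` for which the functions `F_a` are constant along the
differentials of the components of `φ`. -/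
theorem exists_parallel_coordinates (hW : IsOpen W) (hF : ∀ a, ContDiffOn ℝ ∞ (F a) W)
    (hind : ∀ z ∈ W, LinearIndependent ℝ fun a => verticalDeriv (F a) z)
    (hsymm : ∀ z ∈ W, ∀ u v, annihilatorCoeff F z u v = annihilatorCoeff F z v u)
    {z : Coord n × Momenta n} (hz : z ∈ W) :
    ∃ φ : OpenPartialHomeomorph (Coord n) (Coord n), z.1 ∈ φ.source ∧
      ContDiffOn ℝ ∞ φ φ.source ∧ ContDiffOn ℝ ∞ φ.symm φ.target ∧
      ∃ c : Fin n → Fin n → ℝ, ∀ x ∈ φ.source, ∀ k,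
        (x, (basisCovec k).comp (fderiv ℝ φ x)) ∈ W ∧
        ∀ a, F a (x, (basisCovec k).comp (fderiv ℝ φ x)) = c a k := by
  obtain ⟨p, hp, hpW⟩ := exists_linearIndependent_fibre hW hz
  choose θ hθ0 hθ using fun k => exists_parallel_section hW hF hind (hpW k)
  obtain ⟨r, hr, hball⟩ := Metric.eventually_nhds_iff_ball.1 (Filter.eventually_all.2 hθ)
  set B := Metric.ball z.1 r with hB
  let Θ : Coord n → Coord n →L[ℝ] Coord n := fun x => ∑ k, (θ k x).smulRight (basisVec k)
  have hΘ : ∀ x k, (basisCovec k).comp (Θ x) = θ k x := fun x k => by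
    ext v
    simp [Θ, basisCovec, basisVec, sum_apply]
  have hC : ∀ k, ContDiffOn ℝ ∞ (θ k) B := fun k =>
    contDiffOn_of_hasFDerivAt_comp Metric.isOpen_ball (A := fun y => -annihilatorCoeff F y)
      (fun y hy => (contDiffAt_annihilatorCoeff (hind y hy) fun a =>
        (hF a).contDiffAt (hW.mem_nhds hy)).neg.contDiffWithinAt)
      (fun x hx => (hball x hx k).1) (fun x hx => (hball x hx k).2.2)
  have hCΘ : ContDiffOn ℝ ∞ Θ B := ContDiffOn.sum fun k _ =>
    (hC k).smulRight contDiffOn_const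
  -- The rows of `Θ` are the parallel 1-forms. Their derivatives are the symmetric coefficients up
  -- to sign, so they are closed.
  have hdΘ : ∀ x ∈ B, ∀ u v, fderiv ℝ Θ x u v = fderiv ℝ Θ x v u := by
    intro x hx u v
    have h1 : ∀ u v, fderiv ℝ Θ x u v
        = ∑ k, (-annihilatorCoeff F (x, θ k x)) u v • (basisVec k : Coord n) := by
      intro u v
      have h2 : HasFDerivAt (fun y => Θ y v)
          (∑ k, ((ContinuousLinearMap.apply ℝ ℝ v).comp
            (-annihilatorCoeff F (x, θ k x))).smulRight (basisVec k)) x := by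
        simp only [Θ, sum_apply, ContinuousLinearMap.smulRight_apply]
        refine HasFDerivAt.fun_sum fun k _ => HasFDerivAt.smul_const ?_ _
        exact HasFDerivAt.comp (g := ContinuousLinearMap.apply ℝ ℝ v) x
          (ContinuousLinearMap.hasFDerivAt _) (hball x hx k).2.2
      have h3 : HasFDerivAt (fun y => Θ y v) _ x :=
        (((hCΘ.contDiffAt (Metric.isOpen_ball.mem_nhds hx)).differentiableAt
          (by simp)).hasFDerivAt).clm_apply (hasFDerivAt_const v x)
      have h4 := DFunLike.congr_fun (h3.unique h2) u
      simpa [sum_apply] using h4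
    rw [h1, h1]
    refine Finset.sum_congr rfl fun k _ => ?_
    rw [neg_apply, neg_apply, neg_apply, neg_apply, hsymm _ (hball x hx k).1]
  -- Poincaré's lemma on the ball: `Θ` is the derivative of a map `y`, whose components are the new
  -- coordinates.
  obtain ⟨y, hy⟩ := (convex_ball z.1 r).exists_forall_hasFDerivAt_of_fderiv_symmetric
    Metric.isOpen_ball (hCΘ.differentiableOn (by simp)) hdΘ
  have hCy : ContDiffOn ℝ ∞ y B := by
    rw [contDiffOn_infty_iff_fderiv_of_isOpen Metric.isOpen_ball]
    exact ⟨fun x hx => (hy x hx).differentiableAt.differentiableWithinAt,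
      hCΘ.congr fun x hx => (hy x hx).fderiv⟩
  have hz0 : z.1 ∈ B := Metric.mem_ball_self hr
  obtain ⟨L, hL⟩ : ∃ L : Coord n ≃L[ℝ] Coord n, (L : Coord n →L[ℝ] Coord n) = Θ z.1 := by
    have hinj : Function.Injective (Θ z.1) := by
      rw [injective_iff_map_eq_zero]
      intro v hv
      refine pi_injective p finrank_euclideanSpace_fin hp ?_
      ext k
      have h1 := DFunLike.congr_fun (hΘ z.1 k) v
      rw [hθ0] at h1
      simp [← h1, hv]
    exact ⟨(LinearEquiv.ofInjectiveEndo (Θ z.1).toLinearMap hinj).toContinuousLinearEquiv,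
      by ext; rfl⟩
  have hyz : ContDiffAt ℝ ∞ y z.1 := hCy.contDiffAt (Metric.isOpen_ball.mem_nhds hz0)
  have hdz : HasFDerivAt y (L : Coord n →L[ℝ] Coord n) z.1 := hL ▸ hy _ hz0
  set ψ := hyz.toOpenPartialHomeomorph y hdz (by simp) with hψ
  -- The inverse function theorem supplies only a local homeomorphism; cutting down to points where
  -- `Θ` is invertible makes its inverse smooth on the whole target.
  have hO : IsOpen (B ∩ Θ ⁻¹' Set.range ((↑) : (Coord n ≃L[ℝ] Coord n) → _)) :=
    hCΘ.continuousOn.isOpen_inter_preimage Metric.isOpen_ball (ContinuousLinearEquiv.isOpen)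
  set φ := ψ.restrOpen _ hO with hφ
  have hsource : ∀ x ∈ φ.source, x ∈ B ∧ ∃ L : Coord n ≃L[ℝ] Coord n,
      (L : Coord n →L[ℝ] Coord n) = Θ x := fun x hx => by
    rw [hφ, OpenPartialHomeomorph.restrOpen_source] at hx
    exact hx.2
  have hφy : (φ : Coord n → Coord n) = y := rfl
  refine ⟨φ, ?_, ?_, ?_, fun a k => F a (z.1, p k), fun x hx k => ?_⟩
  · rw [hφ, OpenPartialHomeomorph.restrOpen_source]
    exact ⟨hyz.mem_toOpenPartialHomeomorph_source hdz (by simp), hz0, L, hL⟩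
  · rw [hφy]
    exact hCy.mono fun x hx => (hsource x hx).1
  · intro w hw
    have hs := φ.map_target hw
    obtain ⟨h1, L', hL'⟩ := hsource _ hs
    exact (φ.contDiffAt_symm (f₀' := L') hw (by rw [hφy, hL']; exact hy _ h1)
      (by rw [hφy]; exact hCy.contDiffAt (Metric.isOpen_ball.mem_nhds h1))).contDiffWithinAt
  · have h1 := (hsource x hx).1
    rw [hφy, (hy x h1).fderiv, hΘ]
    exact ⟨(hball x h1 k).1, (hball x h1 k).2.1⟩

end ParallelSections

end CotangentConnection

namespace CotangentConnection

/-! ### Change of chart on the cotangent bundle -/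

section ChangeOfChart

variable {n : ℕ} {M : Type*} [TopologicalSpace M] [ChartedSpace (Coord n) M]
  [IsManifold (𝓡 n) ∞ M] {e : OpenPartialHomeomorph M (Coord n)}
  {φ : OpenPartialHomeomorph (Coord n) (Coord n)}

theorem trans_mem_maximalAtlas (he : e ∈ IsManifold.maximalAtlas (𝓡 n) ∞ M)
    (hφ : ContDiffOn ℝ ∞ φ φ.source) (hφ' : ContDiffOn ℝ ∞ φ.symm φ.target) :
    e.trans φ ∈ IsManifold.maximalAtlas (𝓡 n) ∞ M := by
  refine OpenPartialHomeomorph.mem_maximalAtlas_of_contMDiffOn _ ?_ ?_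
  · exact hφ.contMDiffOn.comp ((contMDiffOn_of_mem_maximalAtlas he).mono fun x hx => hx.1)
      fun x hx => hx.2
  · exact (contMDiffOn_symm_of_mem_maximalAtlas he).comp
      (hφ'.contMDiffOn.mono fun x hx => hx.1) fun x hx => hx.2

theorem exists_ofCanonical_eq (he : e ∈ IsManifold.maximalAtlas (𝓡 n) ∞ M)
    {q : CotangentBundle n M} (hq : q.1 ∈ e.source) :
    ∃ z : Coord n × Momenta n, z.1 ∈ e.target ∧ ofCanonical e z = q := by
  obtain ⟨m, p⟩ := q
  obtain ⟨x, hx, rfl⟩ : ∃ x ∈ e.target, e.symm x = m := ⟨e m, e.map_source hq, e.left_inv hq⟩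
  let L : Coord n →L[ℝ] Coord n := mfderiv (𝓡 n) (𝓡 n) e.symm x
  let p' : Momenta n := p
  refine ⟨(x, p'.comp L), hx, congrArg (Bundle.TotalSpace.mk (e.symm x)) ?_⟩
  exact ContinuousLinearMap.ext fun v => congrArg p' (mfderiv_symm_apply_mfderiv he hx v)

/-- The chain rule for `φ ∘ e`: momenta transform by pullback along `φ`. Hence the constant momentum
$dy^k$ in the new chart is the parallel 1-form in the old one. -/
theorem ofCanonical_trans (he : e ∈ IsManifold.maximalAtlas (𝓡 n) ∞ M)
    (hφ : ContDiffOn ℝ ∞ φ φ.source) {y : Coord n} (hy : y ∈ (e.trans φ).target) (p : Momenta n) :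
    ofCanonical (M := M) (e.trans φ) (y, p)
      = ofCanonical e (φ.symm y, p.comp (fderiv ℝ φ (φ.symm y))) := by
  have hs : φ.symm y ∈ φ.source := φ.map_target hy.1
  have ht : φ.symm y ∈ e.target := hy.2
  have h1 : MDifferentiableAt (𝓡 n) (𝓡 n) φ (φ.symm y) :=
    ((hφ.contDiffAt (φ.open_source.mem_nhds hs)).differentiableAt
      (by simp)).mdifferentiableAt
  have h2 : MDifferentiableAt (𝓡 n) (𝓡 n) e (e.symm (φ.symm y)) :=
    (contMDiffAt_of_mem_maximalAtlas he (e.map_target ht)).mdifferentiableAt (by simp)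
  have h3 := mfderiv_comp_of_eq h1 h2 (e.right_inv ht)
  rw [e.right_inv ht, mfderiv_eq_fderiv] at h3
  have h4 : p.comp (mfderiv (𝓡 n) (𝓡 n) (φ ∘ e) (e.symm (φ.symm y)))
      = (p.comp (fderiv ℝ φ (φ.symm y))).comp (mfderiv (𝓡 n) (𝓡 n) e (e.symm (φ.symm y))) := by
    rw [h3]; rfl
  exact congrArg (Bundle.TotalSpace.mk (e.symm (φ.symm y))) h4

end ChangeOfChart

end CotangentConnection

/-! ### Existence of affine charts -/

namespace PseudoRiemannianMetric

open CotangentConnection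

variable {n : ℕ} {M : Type*} [TopologicalSpace M] [ChartedSpace (Coord n) M]
  [IsManifold (𝓡 n) ∞ M] (g : PseudoRiemannianMetric n M)

theorem exists_isAffineChart {U : Set (CotangentBundle n M)} {f : Fin n → CotangentBundle n M → ℝ}
    {H : CotangentBundle n M → ℝ} (hint : IsCompletelyIntegrableOn H f U)
    (hLC : g.EqDualLeviCivita f U) {q : CotangentBundle n M} (hq : q ∈ U) :
    ∃ e : OpenPartialHomeomorph M (Coord n), q.1 ∈ e.source ∧ g.IsAffineChart e := by
  set e := chartAt (Coord n) q.1 with hedef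
  have he : e ∈ IsManifold.maximalAtlas (𝓡 n) ∞ M := IsManifold.chart_mem_maximalAtlas q.1
  have hqe : q.1 ∈ e.source := mem_chart_source _ _
  obtain ⟨z, hze, hzq⟩ := exists_ofCanonical_eq he hqe
  have hz : z ∈ canonicalDomain e U := ⟨hze, by rw [hzq]; exact hq⟩
  have hz1 : e q.1 = z.1 := by rw [← hzq]; exact e.right_inv hze
  obtain ⟨φ, hφ0, hφ, hφ', c, hc⟩ := exists_parallel_coordinates
    (isOpen_canonicalDomain he hint.isOpen)
    (fun a => contDiffOn_inCanonical he hint.isOpen (hint.smooth a)) (hint.transversal e he)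
    (fun z hz => hint.connCoeff_symm he hz) hz
  have he' := trans_mem_maximalAtlas (M := M) he hφ hφ'
  refine ⟨e.trans φ, ?_, he', fun y hy k i j => ?_⟩
  · rw [OpenPartialHomeomorph.trans_source]
    exact ⟨hqe, by rw [Set.mem_preimage, hz1]; exact hφ0⟩
  have hdom : ∀ y ∈ (e.trans φ).target, (y, basisCovec k) ∈ canonicalDomain (e.trans φ) U ∧
      ∀ a, inCanonical (e.trans φ) (f a) (y, basisCovec k) = c a k := by
    intro y hy
    have h1 := hc _ (φ.map_target hy.1) k
    rw [canonicalDomain, Set.mem_ofPred_eq]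
    simp only [inCanonical, ofCanonical_trans he hφ hy]
    exact ⟨⟨hy, h1.1.2⟩, h1.2⟩
  -- Since `f a` is constant along $y\mapsto(y,dy^k)$, its derivative with the momentum held fixed
  -- vanishes.
  have hzero : ∀ a, positionDeriv (inCanonical (e.trans φ) (f a)) (y, basisCovec k) = 0 := by
    intro a
    have h1 := ((contDiffOn_inCanonical he' hint.isOpen (hint.smooth a)).contDiffAt
      ((isOpen_canonicalDomain he' hint.isOpen).mem_nhds (hdom y hy).1)).differentiableAt
      (by simp)
    have h2 : HasFDerivAt (fun x => inCanonical (e.trans φ) (f a) (x, basisCovec k))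
        (positionDeriv (inCanonical (e.trans φ) (f a)) (y, basisCovec k)) y :=
      HasFDerivAt.comp (g := inCanonical (e.trans φ) (f a)) y h1.hasFDerivAt
        (hasFDerivAt_prodMk_left y (basisCovec k))
    exact h2.unique ((hasFDerivAt_const (c a k) y).congr_of_eventuallyEq
      (Filter.eventuallyEq_of_mem ((e.trans φ).open_target.mem_nhds hy)
        fun x hx => (hdom x hx).2 a))
  have hΓ : connCoeff f (e.trans φ) (y, basisCovec k) = 0 := by
    rw [connCoeff, annihilatorCoeff]
    simp only [hzero]
    ext u v
    have : (ContinuousLinearMap.pi fun _ : Fin n => (0 : Coord n →L[ℝ] ℝ)) = 0 := by ext; rfl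
    rw [this, ContinuousLinearMap.comp_zero]
  -- At the momentum $dy^k$ the formula for the dual connection reduces to minus the single symbol
  -- with upper index $k$.
  have h1 := hLC _ he' _ (hdom y hy).1 i j
  rw [hΓ, dualLeviCivitaCoeff] at h1
  simpa [basisCovec, basisVec, Pi.single_apply] using h1

end PseudoRiemannianMetric

end

theorem mainTheorem12 {n : ℕ} {M : Type*} [TopologicalSpace M] [ChartedSpace (Coord n) M]
    [IsManifold (𝓡 n) ∞ M] (g : PseudoRiemannianMetric n M)
    (U : Set (CotangentBundle n M)) (f : Fin n → CotangentBundle n M → ℝ)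
    (hint : CotangentConnection.IsCompletelyIntegrableOn g.geodesicHamiltonian f U)
    (hflat : CotangentConnection.HasFlatLinearization f U) :
    (CotangentConnection.IsLinearConnection f U ∧ g.EqDualLeviCivita f U) ∧
    (∀ q ∈ U, ∃ e : OpenPartialHomeomorph M (Coord n), q.1 ∈ e.source ∧ g.IsAffineChart e) ∧
    (∀ e : OpenPartialHomeomorph M (Coord n), g.IsAffineChart e → IsPreconnected e.source →
      CotangentConnection.HamiltonJacobiSeparable g.geodesicHamiltonian e) ∧
    (∀ e : OpenPartialHomeomorph M (Coord n), g.IsAffineChart e →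
      ∀ i : Fin n, CotangentConnection.IsIgnorable g.geodesicHamiltonian e i) := by
  have hLC := g.eqDualLeviCivita U f hint hflat
  exact ⟨⟨g.isLinearConnection_of_eqDualLeviCivita hLC, hLC⟩,
    fun q hq => g.exists_isAffineChart hint hLC hq,
    fun e he hconn => g.hamiltonJacobiSeparable he hconn, fun e he i => g.isIgnorable he i⟩
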